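/- Let $Q$ be a smooth $D$-dimensional manifold and $L:TQ\to\mathbb R$ a smooth (autonomous) Lagrangian. Let $\tau:TQ\to Q$ be the projection, $\theta_L=\mathbf d_JL$ (in natural coordinates $\theta_L=\frac{\partial L}{\partial v^a}\,dq^a$), $\Omega_L=-d\theta_L$, and $M_{ab}=\frac{\partial^2L}{\partial v^a\partial v^b}$. Assume that $\dim\ker M(u)=N_0$ and $\dim\ker\Omega_L(u)=N_0+\bar D$ are independent of $u\in TQ$ (this holds for every almost regular Lagrangian with $\Omega_L$ of constant rank; in the case $\bar D=N_0$ the second dimension is $2N_0$). Let $\mathcal G$ consist of the vertical vectors $G$ with $i_G\Omega_L=0$. For open $U\subset TQ$, let $\overline{\ker\Omega_L}(U)$ be the space of smooth vector fields $P$ on $U$ with values in $\ker\Omega_L$ such that $[G,P]$ is vertical for every smooth vector field $G$ on $U$ with values in $\mathcal G$; and let $\overline{\ker\Omega_L(u)}\subset\ker\Omega_L(u)$ be the space of values at $u$ of such fields defined near $u$. Then, locally, $\ker\Omega_L$ has a basis that is also a basis of $\overline{\ker\Omega_L}$: every $u_0\in TQ$ has an open neighbourhood $U$ with smooth vector fields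 $P_{(1)},\dots,P_{(\bar D)},G_{(1)},\dots,G_{(N_0)}\in\overline{\ker\Omega_L}(U)$ such that, at each $u\in U$, the vectors $G_{(m)}(u)$ form a basis of $\mathcal G$ at $u$, and the vectors $P_{(n)}(u),G_{(m)}(u)$ form a basis both of $\ker\Omega_L(u)$ and of $\overline{\ker\Omega_L(u)}$. Moreover, such a basis arises by a change of basis from any given one. Let $K_{(1)},\dots,K_{(\bar D)},G_{(1)},\dots,G_{(N_0)}$ be smooth vector fields on an open neighbourhood $W$ of $u_0$ that form a basis of $\ker\Omega_L(u)$ at each $u\in W$, where the $G_{(m)}(u)$ form a basis of $\mathcal G$ at $u$. Then there are an open neighbourhood $U\subset W$ of $u_0$ and smooth functions $\lambda_{lk}{}^m$ and $\omega_n{}^m$ on $U$, with the matrix $(\omega_n{}^m)$ invertible at each point of $U$, such that on $U$ $$T\tau[G_{(l)},K_{(k)}]=\sum_m\lambda_{lk}{}^m\,T\tau K_{(m)},\qquad G_{(l)}\,\omega_n{}^m+\sum_k\omega_n{}^k\lambda_{lk}{}^m=0,$$ and the fields $P_{(n)}=\sum_m\omega_n{}^mK_{(m)}$ together with the $G_{(m)}$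 have all the properties of the preceding paragraph on $U$. -/

import Mathlib

open scoped Manifold ContDiff

noncomputable section

namespace LagrangianPhaseSpace

/-- The model vector space of a `D`-dimensional configuration manifold. -/
abbrev Coord (D : ℕ) : Type := EuclideanSpace ℝ (Fin D)

/-- The model with corners of the tangent bundle `TQ` (a `2D`-dimensional manifold). -/
abbrev tModel (D : ℕ) :
    ModelWithCorners ℝ (Coord D × Coord D) (ModelProd (Coord D) (Coord D)) := (𝓡 D).tangent

/-- The Lagrangian phase space `TQ` of a configuration manifold `Q`. -/
abbrev Phase (D : ℕ) (Q : Type*) [TopologicalSpace Q] [ChartedSpace (Coord D) Q] :=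
  TangentBundle (𝓡 D) Q

section Definitions

variable {D : ℕ} {Q : Type*} [TopologicalSpace Q] [ChartedSpace (Coord D) Q]
  [IsManifold (𝓡 D) ∞ Q]

/-- The tangent space of `TQ` at `u`. -/
abbrev TPhase (u : Phase D Q) := TangentSpace (tModel D) u

/-- (Not necessarily smooth) vector fields on `TQ`. -/
abbrev VField (D : ℕ) (Q : Type*) [TopologicalSpace Q] [ChartedSpace (Coord D) Q]
    [IsManifold (𝓡 D) ∞ Q] :=
  (u : Phase D Q) → TPhase u

/-- The vector field `X` is smooth on the set `U`. -/
def SmoothFieldOn (X : VField D Q) (U : Set (Phase D Q)) : Prop :=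
  ContMDiffOn (tModel D) (tModel D).tangent ∞
    (fun u => (⟨u, X u⟩ : TangentBundle (tModel D) (Phase D Q))) U

/-- The function `f` is smooth on the set `U`. -/
def SmoothFunOn (f : Phase D Q → ℝ) (U : Set (Phase D Q)) : Prop :=
  ContMDiffOn (tModel D) 𝓘(ℝ, ℝ) ∞ f U

/-- The Lie bracket of vector fields on `TQ`. -/
def bracket (X Y : VField D Q) : VField D Q :=
  VectorField.mlieBracket (tModel D) X Y

/-- The derivative `X f` at `u` of a function `f` along the vector field `X`. -/
def dirDeriv (X : VField D Q) (f : Phase D Q → ℝ) (u : Phase D Q) : ℝ :=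
  mvfderiv (tModel D) f u (X u)

/-- The differential `T τ : T(TQ) → TQ` of the bundle projection `τ : TQ → Q`, at `u`. -/
def Ttau (u : Phase D Q) : TPhase u →L[ℝ] TangentSpace (𝓡 D) u.proj :=
  mfderiv (tModel D) (𝓡 D) (Bundle.TotalSpace.proj : Phase D Q → Q) u

/-- The vertical subspace of `T_u(TQ)`. -/
def vertical (u : Phase D Q) : Submodule ℝ (TPhase u) :=
  LinearMap.ker (Ttau u).toLinearMap

/-- The fibre derivative of `L` at `u = (q, v)`: the differential at `v` of `L` restricted to
`T_q Q`. In coordinates, `w ↦ (∂L/∂v^a) w^a`. -/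
def fibreDeriv (L : Phase D Q → ℝ) (u : Phase D Q) :
    TangentSpace (𝓡 D) u.proj →L[ℝ] ℝ :=
  fderiv ℝ (fun w : TangentSpace (𝓡 D) u.proj => L ⟨u.proj, w⟩) u.snd

/-- The Hessian `M_{ab} = ∂²L/∂v^a∂v^b` of `L` at `u = (q, v)`: the second differential at `v`
of `L` restricted to `T_q Q`. -/
def hessian (L : Phase D Q → ℝ) (u : Phase D Q) :
    TangentSpace (𝓡 D) u.proj →L[ℝ] TangentSpace (𝓡 D) u.proj →L[ℝ] ℝ :=
  fderiv ℝ (fun w : TangentSpace (𝓡 D) u.proj => fibreDeriv L ⟨u.proj, w⟩) u.snd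

/-- The one-form `θ_L = d_J L`; in coordinates, `(∂L/∂v^a) dq^a`. -/
def lagrangeOneForm (L : Phase D Q → ℝ) (u : Phase D Q) : TPhase u →L[ℝ] ℝ :=
  (fibreDeriv L u).comp (Ttau u)

/-- The representation of a one-form on `TQ` in the preferred chart of `TQ` at `u`. -/
def oneFormInChart (θ : (u : Phase D Q) → TPhase u →L[ℝ] ℝ) (u : Phase D Q) :
    Coord D × Coord D → (Coord D × Coord D) [⋀^Fin 1]→L[ℝ] ℝ :=
  fun y => ContinuousAlternatingMap.ofSubsingleton ℝ (Coord D × Coord D) ℝ (0 : Fin 1)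
    ((θ ((extChartAt (tModel D) u).symm y)).comp
      (mfderiv 𝓘(ℝ, Coord D × Coord D) (tModel D) (extChartAt (tModel D) u).symm y))

/-- The exterior derivative of a one-form on `TQ`, at `u`, computed in the preferred chart of
`TQ` at `u` and pulled back to the tangent space. -/
def extDerivOneForm (θ : (u : Phase D Q) → TPhase u →L[ℝ] ℝ) (u : Phase D Q) :
    TPhase u [⋀^Fin 2]→L[ℝ] ℝ :=
  (extDeriv (oneFormInChart θ u) (extChartAt (tModel D) u u)).compContinuousLinearMap
    (mfderiv (tModel D) 𝓘(ℝ, Coord D × Coord D) (extChartAt (tModel D) u) u)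

/-- The Lagrange two-form `Ω_L = -dθ_L`. -/
def lagrangeTwoForm (L : Phase D Q → ℝ) (u : Phase D Q) : TPhase u [⋀^Fin 2]→L[ℝ] ℝ :=
  -extDerivOneForm (lagrangeOneForm L) u

/-- `ker Ω_L(u)`: the vectors `K` at `u` with `i_K Ω_L = 0`. -/
def kerOmega (L : Phase D Q → ℝ) (u : Phase D Q) : Submodule ℝ (TPhase u) where
  carrier := {K | ∀ Y : TPhase u, lagrangeTwoForm L u ![K, Y] = 0}
  zero_mem' := fun Y => (lagrangeTwoForm L u).map_coord_zero 0 rfl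
  add_mem' := fun {a b} ha hb Y => by
    have h := (lagrangeTwoForm L u).toMultilinearMap.cons_add ![Y] a b
    exact h.trans (by
      rw [show (lagrangeTwoForm L u).toMultilinearMap (Fin.cons a ![Y]) = 0 from ha Y,
        show (lagrangeTwoForm L u).toMultilinearMap (Fin.cons b ![Y]) = 0 from hb Y, add_zero])
  smul_mem' := fun c a ha Y => by
    have h := (lagrangeTwoForm L u).toMultilinearMap.cons_smul ![Y] c a
    exact h.trans (by
      rw [show (lagrangeTwoForm L u).toMultilinearMap (Fin.cons a ![Y]) = 0 from ha Y,
        smul_zero])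

/-- `𝒢` at `u`: the vertical vectors `G` with `i_G Ω_L = 0`. -/
def vertKer (L : Phase D Q → ℝ) (u : Phase D Q) : Submodule ℝ (TPhase u) :=
  vertical u ⊓ kerOmega L u

/-- The vector fields of `𝒢` on `U`: smooth on `U` with values in `𝒢`. -/
def vertKerFields (L : Phase D Q → ℝ) (U : Set (Phase D Q)) : Set (VField D Q) :=
  {G | SmoothFieldOn G U ∧ ∀ u ∈ U, G u ∈ vertKer L u}

/-- The vector fields of the reduced kernel (`ker Ω_L` with a bar) on `U`: the fields `P`, smooth
on `U`, with values in `ker Ω_L`, such that `[G, P]` is vertical on `U` for all `G` in `𝒢`. -/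
def kerBarFields (L : Phase D Q → ℝ) (U : Set (Phase D Q)) : Set (VField D Q) :=
  {P | SmoothFieldOn P U ∧ (∀ u ∈ U, P u ∈ kerOmega L u) ∧
    ∀ G ∈ vertKerFields L U, ∀ u ∈ U, bracket G P u ∈ vertical u}

/-- The reduced kernel at the point `u`: the space of the values at `u` of the fields of the
reduced kernel that are defined near `u`. -/
def kerBarAt (L : Phase D Q → ℝ) (u : Phase D Q) : Submodule ℝ (TPhase u) :=
  Submodule.span ℝ {X | ∃ U : Set (Phase D Q), IsOpen U ∧ u ∈ U ∧
    ∃ P ∈ kerBarFields L U, P u = X}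

/-- The family `b` is a basis of the subspace `S`. -/
def IsBasisOf {ι V : Type*} [AddCommGroup V] [Module ℝ V] (b : ι → V) (S : Submodule ℝ V) :
    Prop :=
  LinearIndependent ℝ b ∧ Submodule.span ℝ (Set.range b) = S

/-- The smooth vector fields `K_n`, `G_m` form a basis of `ker Ω_L` at every point of `U`, the
`G_m` being a basis of `𝒢`. -/
structure IsKerBasis (L : Phase D Q → ℝ) (U : Set (Phase D Q)) {r s : ℕ}
    (K : Fin r → VField D Q) (G : Fin s → VField D Q) : Prop where
  smooth_K : ∀ n, SmoothFieldOn (K n) U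
  smooth_G : ∀ m, SmoothFieldOn (G m) U
  basis_vert : ∀ u ∈ U, IsBasisOf (fun m => G m u) (vertKer L u)
  basis_ker : ∀ u ∈ U, IsBasisOf (Sum.elim (fun n => K n u) (fun m => G m u)) (kerOmega L u)

/-- A basis of `ker Ω_L` on `U` that is also a basis of the reduced kernel: its members belong to
the reduced kernel on `U`, and they form a basis of the reduced kernel at every point of `U`. -/
structure IsCommonBasis (L : Phase D Q → ℝ) (U : Set (Phase D Q)) {r s : ℕ}
    (P : Fin r → VField D Q) (G : Fin s → VField D Q) : Prop extends IsKerBasis L U P G where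
  mem_P : ∀ n, P n ∈ kerBarFields L U
  mem_G : ∀ m, G m ∈ kerBarFields L U
  basis_bar : ∀ u ∈ U, IsBasisOf (Sum.elim (fun n => P n u) (fun m => G m u)) (kerBarAt L u)

end Definitions

end LagrangianPhaseSpace

end

open LagrangianPhaseSpace

noncomputable section

open scoped Topology
open Set

/-! The point is that a suitable basis can be written down from base coordinates, so the
differential equation for `om` never has to be integrated.

Two facts carry the argument. Since `Ω_L` is exact, `ker Ω_L` is involutive
(`bracket_mem_kerOmega`). And a vector of `ker Ω_L` with zero horizontal part lies in `𝒢`, so the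
horizontal parts of the `K_m` are independent (`IsKerBasis.linearIndependent_base`). Choose linear
functionals `φ j` of the base coordinates `q` dual to these horizontal parts at `u₀`. The matrix `A
k j = K_k(φ j ∘ q)` is the identity at `u₀`, hence invertible nearby, and there a vector `Y` of `ker
Ω_L` is determined modulo vertical vectors by the numbers `Y(φ j ∘ q)`
(`IsKerBasis.sub_mem_vertical`).

Put `om = A⁻¹`. Then `P_n(φ j ∘ q) = δ_nj`. A field `G` of `𝒢` annihilates both these constants and
the functions `φ j ∘ q`, so `[G, P_n]` annihilates every `φ j ∘ q`; as it lies in `ker Ω_L`, it is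
vertical. Applying `[G_l, K_k]` to `φ j ∘ q` gives `lam_l = (G_l A) A⁻¹`, and the equation for `om`
is the derivative of `A⁻¹ A = 1` along `G_l`. The reduced kernel lies in `ker Ω_L` pointwise and
contains the values of a basis of it, so the two agree.

A first basis `K, G` exists because `ker Ω_L` and `𝒢` are kernels of smooth families of linear maps
of constant rank (`exists_kernel_sections`); the rank of `𝒢` is that of `ker M` (`finrank_vertKer`).
-/

namespace LagrangianPhaseSpace

/-! ### Vector fields, derivations and Lie brackets in charts of a boundaryless manifold. -/

section Generic

variable {E : Type*} [NormedAddCommGroup E] [NormedSpace ℝ E]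
  {F : Type*} [NormedAddCommGroup F] [NormedSpace ℝ F]
  {H : Type*} [TopologicalSpace H] {I : ModelWithCorners ℝ E H}
  {M : Type*} [TopologicalSpace M] [ChartedSpace H M]

/-- The derivative of a smooth function along a smooth vector field is smooth. -/
theorem contMDiffOn_mvfderiv_apply [IsManifold I ∞ M] {f : M → F} {X : (u : M) → TangentSpace I u}
    {U : Set M} (hU : IsOpen U) (hf : ContMDiffOn I 𝓘(ℝ, F) ∞ f U)
    (hX : ContMDiffOn I I.tangent ∞ (fun u => (⟨u, X u⟩ : TangentBundle I M)) U) :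
    ContMDiffOn I 𝓘(ℝ, F) ∞ (fun u => mvfderiv I f u (X u)) U := by
  have h1 := (hf.contMDiffOn_tangentMapWithin (m := ∞) (by simp) hU.uniqueMDiffOn).comp hX
    (fun u hu => hu)
  have h2 : ContMDiff 𝓘(ℝ, F).tangent 𝓘(ℝ, F) ∞
      (fun p : TangentBundle 𝓘(ℝ, F) F => (p.2 : F)) := contMDiff_snd_tangentBundle_modelSpace F 𝓘(ℝ, F)
  refine (h2.comp_contMDiffOn h1).congr fun u hu => ?_
  change _ = mfderivWithin I 𝓘(ℝ, F) f U u (X u)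
  rw [mfderivWithin_of_isOpen hU hu]
  rfl

/-- The coordinate expression of a vector field in the preferred chart at `p`. -/
def chartField (I : ModelWithCorners ℝ E H) (p : M) (X : (u : M) → TangentSpace I u) (y : E) : E :=
  mfderiv I 𝓘(ℝ, E) (extChartAt I p) ((extChartAt I p).symm y) (X ((extChartAt I p).symm y))

theorem isOpen_target_inter_preimage [I.Boundaryless] (p : M) {U : Set M} (hU : IsOpen U) :
    IsOpen ((extChartAt I p).target ∩ (extChartAt I p).symm ⁻¹' U) :=
  (continuousOn_extChartAt_symm p).isOpen_inter_preimage (isOpen_extChartAt_target p) hU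

theorem contDiffOn_comp_extChartAt_symm [IsManifold I ∞ M] {f : M → F} {U : Set M}
    (hf : ContMDiffOn I 𝓘(ℝ, F) ∞ f U) (p : M) :
    ContDiffOn ℝ ∞ (f ∘ (extChartAt I p).symm)
      ((extChartAt I p).target ∩ (extChartAt I p).symm ⁻¹' U) :=
  (hf.comp ((contMDiffOn_extChartAt_symm p).mono inter_subset_left)
    (fun _ h => h.2)).contDiffOn

theorem contDiffOn_chartField [IsManifold I ∞ M] {X : (u : M) → TangentSpace I u}
    {U : Set M} (hU : IsOpen U)
    (hX : ContMDiffOn I I.tangent ∞ (fun u => (⟨u, X u⟩ : TangentBundle I M)) U) (p : M) :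
    ContDiffOn ℝ ∞ (chartField I p X)
      ((extChartAt I p).target ∩ (extChartAt I p).symm ⁻¹' U) := by
  have h1 : ContMDiffOn I 𝓘(ℝ, E) ∞ (extChartAt I p) (U ∩ (extChartAt I p).source) := by
    have := contMDiffOn_extChartAt (I := I) (n := ∞) (x := p)
    exact this.mono (by rw [extChartAt_source]; exact inter_subset_right)
  have h2 := contMDiffOn_mvfderiv_apply (hU.inter (isOpen_extChartAt_source p)) h1
    (hX.mono inter_subset_left)
  refine (contDiffOn_comp_extChartAt_symm h2 p).mono fun y hy => ⟨hy.1, hy.2, ?_⟩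
  exact (extChartAt I p).map_target hy.1

theorem mvfderiv_eq_fderiv_chartField [IsManifold I ∞ M] [I.Boundaryless] {f : M → F}
    {u : M} (p : M) (hu : u ∈ (extChartAt I p).source) (hf : MDifferentiableAt I 𝓘(ℝ, F) f u)
    (X : (u : M) → TangentSpace I u) :
    mvfderiv I f u (X u) =
      fderiv ℝ (f ∘ (extChartAt I p).symm) (extChartAt I p u)
        (chartField I p X (extChartAt I p u)) := by
  have hu' := (extChartAt I p).map_source hu
  have e := (extChartAt I p).left_inv hu
  have hs : MDifferentiableAt 𝓘(ℝ, E) I (extChartAt I p).symm (extChartAt I p u) :=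
    ((contMDiffOn_extChartAt_symm (n := ∞) p).contMDiffAt
      ((isOpen_extChartAt_target p).mem_nhds hu')).mdifferentiableAt (by simp)
  have hg : MDifferentiableAt 𝓘(ℝ, E) 𝓘(ℝ, F) (f ∘ (extChartAt I p).symm) (extChartAt I p u) := by
    refine MDifferentiableAt.comp _ ?_ hs
    rwa [e]
  have hc : MDifferentiableAt I 𝓘(ℝ, E) (extChartAt I p) u :=
    mdifferentiableAt_extChartAt (by rwa [extChartAt_source] at hu)
  have key : mfderiv I 𝓘(ℝ, F) f u =
      (mfderiv 𝓘(ℝ, E) 𝓘(ℝ, F) (f ∘ (extChartAt I p).symm) (extChartAt I p u)).comp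
        (mfderiv I 𝓘(ℝ, E) (extChartAt I p) u) := by
    rw [← mfderiv_comp u hg hc]
    apply Filter.EventuallyEq.mfderiv_eq
    filter_upwards [(isOpen_extChartAt_source (I := I) p).mem_nhds hu] with z hz
    rw [Function.comp_apply, Function.comp_apply, (extChartAt I p).left_inv hz]
  have e2 : chartField I p X (extChartAt I p u) = mfderiv I 𝓘(ℝ, E) (extChartAt I p) u (X u) := by
    unfold chartField; rw [e]
  rw [e2]
  change mfderiv I 𝓘(ℝ, F) f u (X u) = _
  rw [key, mfderiv_eq_fderiv]
  rfl

theorem chartField_extChartAt {u p : M} (hu : u ∈ (extChartAt I p).source)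
    (X : (u : M) → TangentSpace I u) :
    chartField I p X (extChartAt I p u) = mfderiv I 𝓘(ℝ, E) (extChartAt I p) u (X u) := by
  unfold chartField; rw [(extChartAt I p).left_inv hu]

/-- The Lie bracket, read in the preferred chart at the point. -/
theorem mfderiv_extChartAt_mlieBracket [IsManifold I ∞ M] [I.Boundaryless] (u : M)
    (X Y : (u : M) → TangentSpace I u) :
    mfderiv I 𝓘(ℝ, E) (extChartAt I u) u (VectorField.mlieBracket I X Y u) =
      VectorField.lieBracket ℝ (chartField I u X) (chartField I u Y) (extChartAt I u u) := by
  have : IsManifold I 1 M := .of_le (n := ∞) (by simp)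
  -- The bracket is defined by pulling back along the inverse chart. That pullback inverts the
  -- derivative of the inverse chart, which gives the derivative of the chart.
  have key : ∀ X : (u : M) → TangentSpace I u,
      VectorField.mpullbackWithin 𝓘(ℝ, E) I (extChartAt I u).symm X (range I)
        =ᶠ[𝓝 (extChartAt I u u)] chartField I u X := by
    intro X
    filter_upwards [extChartAt_target_mem_nhds (I := I) u] with y hy
    rw [VectorField.mpullbackWithin_apply]
    have := ContinuousLinearMap.inverse_eq
      (mfderivWithin_extChartAt_symm_comp_mfderiv_extChartAt (I := I) hy)
      (mfderiv_extChartAt_comp_mfderivWithin_extChartAt_symm (I := I) hy)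
    rw [this]
    rfl
  rw [← VectorField.mlieBracketWithin_univ, VectorField.mlieBracketWithin_apply]
  have h := Filter.EventuallyEq.lieBracket_vectorField_eq (𝕜 := ℝ) (key X) (key Y)
  rw [← h]
  simp only [I.range_eq_univ, preimage_univ, inter_univ]
  refine ((isInvertible_mfderiv_extChartAt (mem_extChartAt_source (I := I) u)).self_apply_inverse
    _).trans ?_
  exact congrFun (VectorField.lieBracketWithin_univ (E := E)) _

/-- On expanding the right side, the two second-derivative terms cancel by symmetry of the second
derivative. -/
theorem fderiv_lieBracket_apply {V W : E → E} {g : E → F} {y : E} (hV : DifferentiableAt ℝ V y)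
    (hW : DifferentiableAt ℝ W y) (hg : ContDiffAt ℝ 2 g y) :
    fderiv ℝ g y (VectorField.lieBracket ℝ V W y) =
      fderiv ℝ (fun z => fderiv ℝ g z (W z)) y (V y) -
        fderiv ℝ (fun z => fderiv ℝ g z (V z)) y (W y) := by
  have hd : DifferentiableAt ℝ (fderiv ℝ g) y :=
    (hg.fderiv_right (m := 1) (by norm_num)).differentiableAt (by simp)
  rw [fderiv_clm_apply hd hW, fderiv_clm_apply hd hV]
  have hs : IsSymmSndFDerivAt ℝ g y := hg.isSymmSndFDerivAt (by simp)
  have := hs.eq (V y) (W y)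
  simp [VectorField.lieBracket, this]

/-- The Lie bracket acts on functions as a commutator. -/
theorem mvfderiv_mlieBracket [IsManifold I ∞ M] [I.Boundaryless] {f : M → F}
    {X Y : (u : M) → TangentSpace I u} {U : Set M} (hU : IsOpen U)
    (hf : ContMDiffOn I 𝓘(ℝ, F) ∞ f U)
    (hX : ContMDiffOn I I.tangent ∞ (fun u => (⟨u, X u⟩ : TangentBundle I M)) U)
    (hY : ContMDiffOn I I.tangent ∞ (fun u => (⟨u, Y u⟩ : TangentBundle I M)) U)
    {u : M} (hu : u ∈ U) :
    mvfderiv I f u (VectorField.mlieBracket I X Y u) =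
      mvfderiv I (fun z => mvfderiv I f z (Y z)) u (X u) -
        mvfderiv I (fun z => mvfderiv I f z (X z)) u (Y u) := by
  have hs := mem_extChartAt_source (I := I) u
  have hmd : ∀ {g : M → F}, ContMDiffOn I 𝓘(ℝ, F) ∞ g U → ∀ z ∈ U,
      MDifferentiableAt I 𝓘(ℝ, F) g z := fun hg z hz =>
    (hg.contMDiffAt (hU.mem_nhds hz)).mdifferentiableAt (by simp)
  have hO := isOpen_target_inter_preimage (I := I) u hU
  have huO : extChartAt I u u ∈ (extChartAt I u).target ∩ (extChartAt I u).symm ⁻¹' U :=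
    ⟨mem_extChartAt_target u, by simpa using hu⟩
  have hn := hO.mem_nhds huO
  rw [mvfderiv_eq_fderiv_chartField u hs (hmd hf u hu),
    mvfderiv_eq_fderiv_chartField u hs (hmd (contMDiffOn_mvfderiv_apply hU hf hY) u hu),
    mvfderiv_eq_fderiv_chartField u hs (hmd (contMDiffOn_mvfderiv_apply hU hf hX) u hu),
    chartField_extChartAt hs, mfderiv_extChartAt_mlieBracket]
  have hev : ∀ X : (u : M) → TangentSpace I u,
      (fun z => mvfderiv I f z (X z)) ∘ (extChartAt I u).symm =ᶠ[𝓝 (extChartAt I u u)]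
        fun y => fderiv ℝ (f ∘ (extChartAt I u).symm) y (chartField I u X y) := by
    intro X
    filter_upwards [hn] with y hy
    have := mvfderiv_eq_fderiv_chartField u ((extChartAt I u).map_target hy.1) (hmd hf _ hy.2) X
    rw [(extChartAt I u).right_inv hy.1] at this
    exact this
  rw [(hev X).fderiv_eq, (hev Y).fderiv_eq]
  have hdiff : ∀ {X : (u : M) → TangentSpace I u},
      ContMDiffOn I I.tangent ∞ (fun u => (⟨u, X u⟩ : TangentBundle I M)) U →
      DifferentiableAt ℝ (chartField I u X) (extChartAt I u u) := fun hX =>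
    ((contDiffOn_chartField hU hX u).contDiffAt hn).differentiableAt (by simp)
  rw [fderiv_lieBracket_apply (hdiff hX) (hdiff hY)
    (contDiffAt_infty.1 ((contDiffOn_comp_extChartAt_symm hf u).contDiffAt hn) 2)]

end Generic

/-! ### Coordinates `(q, v)` on `TQ`: vertical vectors and the form `θ_L`. -/

section PhaseCharts

variable {D : ℕ} {Q : Type*} [TopologicalSpace Q] [ChartedSpace (Coord D) Q]
  [IsManifold (𝓡 D) ∞ Q]

theorem mem_extChartAt_phase_source (p u : Phase D Q) :
    u ∈ (extChartAt (tModel D) p).source ↔ u.proj ∈ (extChartAt (𝓡 D) p.proj).source := by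
  rw [extChartAt_source, extChartAt_source, TangentBundle.mem_chart_source_iff]

theorem extChartAt_phase_target (p : Phase D Q) :
    (extChartAt (tModel D) p).target = (extChartAt (𝓡 D) p.proj).target ×ˢ univ := by
  ext y
  rw [extChartAt_target, extChartAt_target]
  rw [mem_prod, ModelWithCorners.range_eq_univ, ModelWithCorners.range_eq_univ, inter_univ,
    inter_univ, mem_preimage, TangentBundle.mem_chart_target_iff]
  exact (and_iff_left (mem_univ _)).symm

/-- The linear identification of the coordinate space with the tangent space at `b`, given by the
preferred trivialization at `q`. -/
def fibreMap (q b : Q) : Coord D →L[ℝ] TangentSpace (𝓡 D) b :=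
  (trivializationAt (Coord D) (TangentSpace (𝓡 D)) q).symmL ℝ b

theorem extChartAt_phase_symm (p : Phase D Q) {y : Coord D × Coord D}
    (hy : y ∈ (extChartAt (tModel D) p).target) :
    (extChartAt (tModel D) p).symm y =
      ⟨(extChartAt (𝓡 D) p.proj).symm y.1, fibreMap p.proj _ y.2⟩ := by
  rw [extChartAt_phase_target] at hy
  have hb : (extChartAt (𝓡 D) p.proj).symm y.1 ∈
      (trivializationAt (Coord D) (TangentSpace (𝓡 D)) p.proj).baseSet := by
    rw [TangentBundle.trivializationAt_baseSet, ← extChartAt_source (𝓡 D)]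
    exact (extChartAt (𝓡 D) p.proj).map_target hy.1
  have h := (trivializationAt (Coord D) (TangentSpace (𝓡 D)) p.proj).mk_symm hb y.2
  rw [← Bundle.Trivialization.symmL_apply (R := ℝ) _ hb] at h
  exact h.symm

theorem fibreMap_self (q : Q) : fibreMap (D := D) q q = ContinuousLinearMap.id ℝ _ := by
  unfold fibreMap
  rw [TangentBundle.symmL_trivializationAt (mem_chart_source _ q)]
  exact mfderivWithin_range_extChartAt_symm

theorem fibreMap_eq_mfderiv {q : Q} {y : Coord D} (hy : y ∈ (extChartAt (𝓡 D) q).target) :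
    fibreMap q ((extChartAt (𝓡 D) q).symm y) =
      mfderiv 𝓘(ℝ, Coord D) (𝓡 D) (extChartAt (𝓡 D) q).symm y := by
  have h := TangentBundle.symmL_trivializationAt (I := 𝓡 D)
    (x := (extChartAt (𝓡 D) q).symm y) (x₀ := q)
    (by rw [← extChartAt_source (𝓡 D)]; exact (extChartAt (𝓡 D) q).map_target hy)
  unfold fibreMap
  rw [h, (extChartAt (𝓡 D) q).right_inv hy, ModelWithCorners.range_eq_univ, mfderivWithin_univ]

theorem contMDiff_phase_proj :
    ContMDiff (tModel D) (𝓡 D) ∞ (Bundle.TotalSpace.proj : Phase D Q → Q) :=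
  Bundle.contMDiff_proj (TangentSpace (𝓡 D))

/-- The derivative of the inverse chart of `TQ`, followed by `T τ`. -/
theorem Ttau_mfderiv_symm (p : Phase D Q) {y : Coord D × Coord D}
    (hy : y ∈ (extChartAt (tModel D) p).target) (z : Coord D × Coord D) :
    Ttau ((extChartAt (tModel D) p).symm y)
      (mfderiv 𝓘(ℝ, Coord D × Coord D) (tModel D) (extChartAt (tModel D) p).symm y z) =
      fibreMap p.proj ((extChartAt (𝓡 D) p.proj).symm y.1) z.1 := by
  have hy1 : y.1 ∈ (extChartAt (𝓡 D) p.proj).target := by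
    rw [extChartAt_phase_target] at hy; exact hy.1
  have hs : MDifferentiableAt 𝓘(ℝ, Coord D × Coord D) (tModel D)
      (extChartAt (tModel D) p).symm y :=
    ((contMDiffOn_extChartAt_symm (n := ∞) p).contMDiffAt
      ((isOpen_extChartAt_target p).mem_nhds hy)).mdifferentiableAt (by simp)
  have hs1 : MDifferentiableAt 𝓘(ℝ, Coord D) (𝓡 D) (extChartAt (𝓡 D) p.proj).symm y.1 :=
    ((contMDiffOn_extChartAt_symm (n := ∞) p.proj).contMDiffAt
      ((isOpen_extChartAt_target p.proj).mem_nhds hy1)).mdifferentiableAt (by simp)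
  have hp : MDifferentiableAt (tModel D) (𝓡 D) (Bundle.TotalSpace.proj : Phase D Q → Q)
      ((extChartAt (tModel D) p).symm y) :=
    (contMDiff_phase_proj _).mdifferentiableAt (by simp)
  have hf : MDifferentiableAt 𝓘(ℝ, Coord D × Coord D) 𝓘(ℝ, Coord D)
      (Prod.fst : Coord D × Coord D → Coord D) y :=
    differentiableAt_fst.mdifferentiableAt
  rw [fibreMap_eq_mfderiv hy1]
  have h1 := mfderiv_comp y hp hs
  have h2 := mfderiv_comp y hs1 hf
  -- In charts `τ` is the first projection; the two chain rules for this one map are compared.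
  have e : (Bundle.TotalSpace.proj : Phase D Q → Q) ∘ (extChartAt (tModel D) p).symm =
      (extChartAt (𝓡 D) p.proj).symm ∘ Prod.fst := rfl
  rw [e, h2] at h1
  have h3 := congrArg (fun A => A z) h1
  rw [mfderiv_eq_fderiv, fderiv_fst] at h3
  exact h3.symm

theorem fderiv_comp_inr_apply {V W F : Type*} [NormedAddCommGroup V] [NormedSpace ℝ V]
    [NormedAddCommGroup W] [NormedSpace ℝ W] [NormedAddCommGroup F] [NormedSpace ℝ F]
    {l : V × W → F} {y : V × W} (hl : DifferentiableAt ℝ l y) (a : W) :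
    fderiv ℝ l y (0, a) = fderiv ℝ (fun w => l (y.1, w)) y.2 a := by
  have h := HasFDerivAt.comp (g := l) (f := fun w => (y.1, w)) y.2 hl.hasFDerivAt
    (hasFDerivAt_prodMk_right (𝕜 := ℝ) y.1 y.2)
  exact (congrArg (fun A => A a) h.fderiv).symm

theorem fderiv_comp_equiv_apply {V W F : Type*} [NormedAddCommGroup V] [NormedSpace ℝ V]
    [NormedAddCommGroup W] [NormedSpace ℝ W] [NormedAddCommGroup F] [NormedSpace ℝ F]
    (e : V ≃L[ℝ] W) (f : W → F) (v a : V) :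
    fderiv ℝ (fun w => f (e w)) v a = fderiv ℝ f (e v) (e a) :=
  congrArg (fun A => A a) (e.comp_right_fderiv (f := f) (x := v))

/-- In a chart, the fibre derivative is the derivative in the fibre directions. -/
theorem fibreDeriv_chart (L : Phase D Q → ℝ) (hL : ContMDiff (tModel D) 𝓘(ℝ, ℝ) ∞ L)
    (p : Phase D Q) {y : Coord D × Coord D}
    (hy : y ∈ (extChartAt (tModel D) p).target) (a : Coord D) :
    fibreDeriv L ((extChartAt (tModel D) p).symm y)
      (fibreMap p.proj ((extChartAt (𝓡 D) p.proj).symm y.1) a) =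
      fderiv ℝ (L ∘ (extChartAt (tModel D) p).symm) y (0, a) := by
  have hy1 : y.1 ∈ (extChartAt (𝓡 D) p.proj).target := by
    rw [extChartAt_phase_target] at hy; exact hy.1
  -- Composition with a linear equivalence commutes with `fderiv` without any differentiability
  -- assumption, so invertibility of the fibre identification is what is needed.
  obtain ⟨e, he⟩ : (fibreMap p.proj ((extChartAt (𝓡 D) p.proj).symm y.1)).IsInvertible := by
    have h := isInvertible_mfderivWithin_extChartAt_symm (I := 𝓡 D) hy1
    rwa [ModelWithCorners.range_eq_univ, mfderivWithin_univ, ← fibreMap_eq_mfderiv hy1] at h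
  have hsymm : ∀ w : Coord D, (extChartAt (tModel D) p).symm (y.1, w) =
      ⟨(extChartAt (𝓡 D) p.proj).symm y.1, e w⟩ := by
    intro w
    rw [extChartAt_phase_symm p (by rw [extChartAt_phase_target]; exact ⟨hy1, mem_univ _⟩), ← he]
    rfl
  have hl : DifferentiableAt ℝ (L ∘ (extChartAt (tModel D) p).symm) y :=
    ((contDiffOn_comp_extChartAt_symm (U := univ) hL.contMDiffOn p).contDiffAt
      ((isOpen_target_inter_preimage p isOpen_univ).mem_nhds ⟨hy, mem_univ _⟩)).differentiableAt
      (by simp)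
  have h1 := fderiv_comp_inr_apply hl a
  have h2 := fderiv_comp_equiv_apply (W := Coord D) e
    (fun w => L ⟨(extChartAt (𝓡 D) p.proj).symm y.1, w⟩) y.2 a
  rw [h1, ← he]
  have h3 : (fun w => (L ∘ (extChartAt (tModel D) p).symm) (y.1, w)) =
    fun w => L ⟨(extChartAt (𝓡 D) p.proj).symm y.1, e w⟩ := by
    funext w
    rw [Function.comp_apply, hsymm]
  rw [h3]
  refine Eq.trans ?_ h2.symm
  have h4 := hsymm y.2
  rw [Prod.mk.eta] at h4
  rw [h4]
  rfl

/-- The first component of the chart derivative is `T τ` followed by the derivative of the chart of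
`Q`, which is injective. -/
theorem mem_vertical_iff (p : Phase D Q) {u : Phase D Q}
    (hu : u ∈ (extChartAt (tModel D) p).source) (X : TPhase u) :
    X ∈ vertical u ↔
      (mfderiv (tModel D) 𝓘(ℝ, Coord D × Coord D) (extChartAt (tModel D) p) u X).1 = 0 := by
  have hq := (mem_extChartAt_phase_source p u).1 hu
  have hc : MDifferentiableAt (tModel D) 𝓘(ℝ, Coord D × Coord D) (extChartAt (tModel D) p) u :=
    mdifferentiableAt_extChartAt (by rwa [extChartAt_source] at hu)
  have hcq : MDifferentiableAt (𝓡 D) 𝓘(ℝ, Coord D) (extChartAt (𝓡 D) p.proj) u.proj :=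
    mdifferentiableAt_extChartAt (by rwa [extChartAt_source] at hq)
  have hp : MDifferentiableAt (tModel D) (𝓡 D) (Bundle.TotalSpace.proj : Phase D Q → Q) u :=
    (contMDiff_phase_proj _).mdifferentiableAt (by simp)
  have hf : MDifferentiableAt 𝓘(ℝ, Coord D × Coord D) 𝓘(ℝ, Coord D)
      (Prod.fst : Coord D × Coord D → Coord D) (extChartAt (tModel D) p u) :=
    differentiableAt_fst.mdifferentiableAt
  have h1 := mfderiv_comp u hcq hp
  have h2 := mfderiv_comp u hf hc
  have e : extChartAt (𝓡 D) p.proj ∘ (Bundle.TotalSpace.proj : Phase D Q → Q) =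
      Prod.fst ∘ extChartAt (tModel D) p := rfl
  rw [e, h2, mfderiv_eq_fderiv, fderiv_fst] at h1
  have h3 : (mfderiv (tModel D) 𝓘(ℝ, Coord D × Coord D) (extChartAt (tModel D) p) u X).1 =
    mfderiv (𝓡 D) 𝓘(ℝ, Coord D) (extChartAt (𝓡 D) p.proj) u.proj (Ttau u X) :=
    congrArg (fun A => A X) h1
  rw [h3]
  have hi := (isInvertible_mfderiv_extChartAt hq).injective
  exact ⟨fun h => (congrArg _ h).trans (map_zero _), fun h =>
    hi (h.trans (map_zero _).symm)⟩

/-- The one-form `θ_L` in a chart of `TQ`, where `ℓ` is the coordinate expression of `L`. -/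
def chartOneForm {V : Type*} [NormedAddCommGroup V] [NormedSpace ℝ V] (l : V × V → ℝ) (y : V × V) :
    V × V →L[ℝ] ℝ :=
  (fderiv ℝ l y).comp ((ContinuousLinearMap.inr ℝ V V).comp (ContinuousLinearMap.fst ℝ V V))

/-- This is `θ_L = (∂l/∂v) dq` on the whole domain of one fixed chart, so it can be differentiated
there. -/
theorem oneFormInChart_eq (L : Phase D Q → ℝ) (hL : ContMDiff (tModel D) 𝓘(ℝ, ℝ) ∞ L)
    (p : Phase D Q) {y : Coord D × Coord D}
    (hy : y ∈ (extChartAt (tModel D) p).target) :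
    oneFormInChart (lagrangeOneForm L) p y =
      ContinuousAlternatingMap.ofSubsingleton ℝ (Coord D × Coord D) ℝ (0 : Fin 1)
        (chartOneForm (L ∘ (extChartAt (tModel D) p).symm) y) := by
  unfold oneFormInChart
  congr 1
  refine ContinuousLinearMap.ext fun z => ?_
  have h := fibreDeriv_chart L hL p hy z.1
  rw [← Ttau_mfderiv_symm p hy] at h
  exact h

end PhaseCharts

/-! ### The form `dθ_L`: independence of the chart and coordinate expression. -/

section TwoForm

variable {D : ℕ} {Q : Type*} [TopologicalSpace Q] [ChartedSpace (Coord D) Q]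
  [IsManifold (𝓡 D) ∞ Q]

theorem contDiffOn_lagrangian_chart {L : Phase D Q → ℝ} (hL : ContMDiff (tModel D) 𝓘(ℝ, ℝ) ∞ L)
    (p : Phase D Q) :
    ContDiffOn ℝ ∞ (L ∘ (extChartAt (tModel D) p).symm) (extChartAt (tModel D) p).target :=
  (contDiffOn_comp_extChartAt_symm (U := univ) hL.contMDiffOn p).mono
    fun _ hy => ⟨hy, mem_univ _⟩

theorem contDiffOn_oneFormInChart {L : Phase D Q → ℝ} (hL : ContMDiff (tModel D) 𝓘(ℝ, ℝ) ∞ L)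
    (p : Phase D Q) :
    ContDiffOn ℝ ∞ (oneFormInChart (lagrangeOneForm L) p) (extChartAt (tModel D) p).target := by
  have h1 := (contDiffOn_lagrangian_chart hL p).fderiv_of_isOpen (isOpen_extChartAt_target p)
    (m := ∞) (by simp)
  have h2 : ContDiffOn ℝ ∞ (chartOneForm (L ∘ (extChartAt (tModel D) p).symm))
      (extChartAt (tModel D) p).target := h1.clm_comp contDiffOn_const
  refine ContDiffOn.congr ?_ fun y hy => oneFormInChart_eq L hL p hy
  exact (ContinuousAlternatingMap.ofSubsingletonLIE (𝕜 := ℝ) (E := Coord D × Coord D) (F := ℝ)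
    (0 : Fin 1)).contDiff.comp_contDiffOn h2

/-- The type of `θ u` depends on `u`. Taking the vectors in the common model space allows the base
point and the vector to be replaced together. -/
theorem oneForm_congr (θ : (u : Phase D Q) → TPhase u →L[ℝ] ℝ) {u v : Phase D Q} (h : u = v)
    {A B : Coord D × Coord D} (hAB : A = B) : θ u A = θ v B := by
  subst h; subst hAB; rfl

/-- The inverse chart at `u` is locally the inverse chart at `p` after the transition map, so the
chain rule identifies the two arguments of `θ`. -/
theorem oneFormInChart_eventuallyEq_pullback (θ : (u : Phase D Q) → TPhase u →L[ℝ] ℝ)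
    {p u : Phase D Q} (hu : u ∈ (extChartAt (tModel D) p).source) :
    oneFormInChart θ u =ᶠ[𝓝 (extChartAt (tModel D) u u)] fun y =>
      (oneFormInChart θ p ((extChartAt (tModel D) p ∘ (extChartAt (tModel D) u).symm) y)
        ).compContinuousLinearMap
        (fderiv ℝ (extChartAt (tModel D) p ∘ (extChartAt (tModel D) u).symm) y) := by
  have hO := isOpen_target_inter_preimage (I := tModel D) u
    (isOpen_extChartAt_source (I := tModel D) p)
  have hmem : extChartAt (tModel D) u u ∈ (extChartAt (tModel D) u).target ∩
      (extChartAt (tModel D) u).symm ⁻¹' (extChartAt (tModel D) p).source :=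
    ⟨mem_extChartAt_target u, by rwa [mem_preimage, extChartAt_to_inv]⟩
  filter_upwards [hO.mem_nhds hmem] with y hy
  have hs : MDifferentiableAt 𝓘(ℝ, Coord D × Coord D) (tModel D)
      (extChartAt (tModel D) u).symm y :=
    ((contMDiffOn_extChartAt_symm (n := ∞) u).contMDiffAt
      ((isOpen_extChartAt_target u).mem_nhds hy.1)).mdifferentiableAt (by simp)
  have hc : MDifferentiableAt (tModel D) 𝓘(ℝ, Coord D × Coord D) (extChartAt (tModel D) p)
      ((extChartAt (tModel D) u).symm y) :=
    mdifferentiableAt_extChartAt (by have := hy.2; rwa [mem_preimage, extChartAt_source] at this)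
  have hps : MDifferentiableAt 𝓘(ℝ, Coord D × Coord D) (tModel D)
      (extChartAt (tModel D) p).symm
      ((extChartAt (tModel D) p ∘ (extChartAt (tModel D) u).symm) y) :=
    ((contMDiffOn_extChartAt_symm (n := ∞) p).contMDiffAt
      ((isOpen_extChartAt_target p).mem_nhds
        ((extChartAt (tModel D) p).map_source hy.2))).mdifferentiableAt (by simp)
  have hev : (extChartAt (tModel D) u).symm =ᶠ[𝓝 y] (extChartAt (tModel D) p).symm ∘
      (extChartAt (tModel D) p ∘ (extChartAt (tModel D) u).symm) := by
    filter_upwards [hO.mem_nhds hy] with z hz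
    exact ((extChartAt (tModel D) p).left_inv hz.2).symm
  have hm := hev.mfderiv_eq (I := 𝓘(ℝ, Coord D × Coord D)) (I' := tModel D)
  have hcomp := mfderiv_comp y hps (hc.comp y hs)
  rw [mfderiv_eq_fderiv] at hcomp
  ext v
  refine oneForm_congr θ hev.eq_of_nhds ?_
  exact congrArg (fun A => A (v 0)) (hm.trans hcomp)

/-- The exterior derivative of `θ_L` may be computed in any chart. -/
theorem extDerivOneForm_eq {L : Phase D Q → ℝ} (hL : ContMDiff (tModel D) 𝓘(ℝ, ℝ) ∞ L)
    {p u : Phase D Q} (hu : u ∈ (extChartAt (tModel D) p).source) (X Y : TPhase u) :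
    extDerivOneForm (lagrangeOneForm L) u ![X, Y] =
      extDeriv (oneFormInChart (lagrangeOneForm L) p) (extChartAt (tModel D) p u)
        ![mfderiv (tModel D) 𝓘(ℝ, Coord D × Coord D) (extChartAt (tModel D) p) u X,
          mfderiv (tModel D) 𝓘(ℝ, Coord D × Coord D) (extChartAt (tModel D) p) u Y] := by
  set t := extChartAt (tModel D) p ∘ (extChartAt (tModel D) u).symm with ht
  have ht0 : t (extChartAt (tModel D) u u) = extChartAt (tModel D) p u := by
    rw [ht, Function.comp_apply, extChartAt_to_inv]
  have hcu : MDifferentiableAt (tModel D) 𝓘(ℝ, Coord D × Coord D) (extChartAt (tModel D) u) u :=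
    mdifferentiableAt_extChartAt (mem_chart_source _ u)
  have hO := isOpen_target_inter_preimage (I := tModel D) u
    (isOpen_extChartAt_source (I := tModel D) p)
  have hmem : extChartAt (tModel D) u u ∈ (extChartAt (tModel D) u).target ∩
      (extChartAt (tModel D) u).symm ⁻¹' (extChartAt (tModel D) p).source :=
    ⟨mem_extChartAt_target u, by rwa [mem_preimage, extChartAt_to_inv]⟩
  have hcp : ContMDiffOn (tModel D) 𝓘(ℝ, Coord D × Coord D) ∞ (extChartAt (tModel D) p)
      (extChartAt (tModel D) p).source := by
    rw [extChartAt_source]; exact contMDiffOn_extChartAt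
  have htd : ContDiffAt ℝ ∞ t (extChartAt (tModel D) u u) :=
    (contDiffOn_comp_extChartAt_symm hcp u).contDiffAt (hO.mem_nhds hmem)
  have hω : DifferentiableAt ℝ (oneFormInChart (lagrangeOneForm L) p)
      (t (extChartAt (tModel D) u u)) := by
    rw [ht0]
    exact ((contDiffOn_oneFormInChart hL p).contDiffAt ((isOpen_extChartAt_target p).mem_nhds
      ((extChartAt (tModel D) p).map_source hu))).differentiableAt (by simp)
  -- Naturality of the exterior derivative under the transition map `t`.
  have h1 := (oneFormInChart_eventuallyEq_pullback (lagrangeOneForm L) hu).extDeriv_eq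
  rw [← ht, extDeriv_pullback hω (contDiffAt_infty.1 htd 2) (by simp), ht0] at h1
  have h2 : ∀ Z : TPhase u,
      fderiv ℝ t (extChartAt (tModel D) u u)
        (mfderiv (tModel D) 𝓘(ℝ, Coord D × Coord D) (extChartAt (tModel D) u) u Z) =
      mfderiv (tModel D) 𝓘(ℝ, Coord D × Coord D) (extChartAt (tModel D) p) u Z := by
    intro Z
    have hev : t ∘ extChartAt (tModel D) u =ᶠ[𝓝 u] extChartAt (tModel D) p := by
      filter_upwards [extChartAt_source_mem_nhds (I := tModel D) u] with z hz
      rw [ht, Function.comp_apply, Function.comp_apply, (extChartAt (tModel D) u).left_inv hz]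
    have hc := mfderiv_comp u (g := t) (htd.differentiableAt (by simp)).mdifferentiableAt hcu
    rw [hev.mfderiv_eq, mfderiv_eq_fderiv] at hc
    exact (congrArg (fun A => A Z) hc).symm
  unfold extDerivOneForm
  rw [h1]
  refine congrArg (extDeriv (oneFormInChart (lagrangeOneForm L) p) (extChartAt (tModel D) p u)) ?_
  funext i
  fin_cases i
  · exact h2 X
  · exact h2 Y

/-- `Ω_L(u)` is defined through the preferred chart at `u`, which varies with `u`; smoothness
arguments need one chart `p` for all nearby `u`. Surjectivity of the chart derivative allows testing
against model vectors. -/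
theorem mem_kerOmega_iff {L : Phase D Q → ℝ} (hL : ContMDiff (tModel D) 𝓘(ℝ, ℝ) ∞ L)
    {p u : Phase D Q} (hu : u ∈ (extChartAt (tModel D) p).source) (X : TPhase u) :
    X ∈ kerOmega L u ↔ ∀ z : Coord D × Coord D,
      extDeriv (oneFormInChart (lagrangeOneForm L) p) (extChartAt (tModel D) p u)
        ![mfderiv (tModel D) 𝓘(ℝ, Coord D × Coord D) (extChartAt (tModel D) p) u X, z] = 0 := by
  have hs := (isInvertible_mfderiv_extChartAt hu).surjective
  have key : ∀ Y : TPhase u, lagrangeTwoForm L u ![X, Y] = -extDeriv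
      (oneFormInChart (lagrangeOneForm L) p) (extChartAt (tModel D) p u)
        ![mfderiv (tModel D) 𝓘(ℝ, Coord D × Coord D) (extChartAt (tModel D) p) u X,
          mfderiv (tModel D) 𝓘(ℝ, Coord D × Coord D) (extChartAt (tModel D) p) u Y] := fun Y =>
    congrArg Neg.neg (extDerivOneForm_eq hL hu X Y)
  constructor
  · intro h z
    obtain ⟨Y, hY⟩ := hs z
    have h1 := key Y
    rw [hY, h Y] at h1
    exact neg_eq_zero.1 h1.symm
  · intro h Y
    exact (key Y).trans (neg_eq_zero.2 (h _))

theorem extDeriv_ofSubsingleton_chartOneForm {V : Type*} [NormedAddCommGroup V] [NormedSpace ℝ V]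
    {l : V × V → ℝ} {y : V × V} (hl : ContDiffAt ℝ 2 l y) (z z' : V × V) :
    extDeriv (fun y => ContinuousAlternatingMap.ofSubsingleton ℝ (V × V) ℝ (0 : Fin 1)
        (chartOneForm l y)) y ![z, z'] =
      fderiv ℝ (fderiv ℝ l) y z (0, z'.1) - fderiv ℝ (fderiv ℝ l) y z' (0, z.1) := by
  have hd : DifferentiableAt ℝ (fderiv ℝ l) y :=
    (hl.fderiv_right (m := 1) (by norm_num)).differentiableAt (by simp)
  have hd1 : DifferentiableAt ℝ (chartOneForm l) y := hd.clm_comp (differentiableAt_const _)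
  have hd2 : DifferentiableAt ℝ (fun y => ContinuousAlternatingMap.ofSubsingleton ℝ (V × V) ℝ
      (0 : Fin 1) (chartOneForm l y)) y :=
    (ContinuousAlternatingMap.ofSubsingletonLIE (𝕜 := ℝ) (E := V × V) (F := ℝ)
      (0 : Fin 1)).differentiableAt.comp y hd1
  have key : ∀ w w' : V × V, fderiv ℝ (fun x => chartOneForm l x w) y w' =
      fderiv ℝ (fderiv ℝ l) y w' (0, w.1) := by
    intro w w'
    change fderiv ℝ (fun x => fderiv ℝ l x (0, w.1)) y w' = _
    rw [fderiv_clm_apply hd (differentiableAt_const _)]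
    simp
  rw [extDeriv_apply hd2, Fin.sum_univ_two]
  have h1 : fderiv ℝ (fun x => chartOneForm l x z') y z = _ := key z' z
  have h2 : fderiv ℝ (fun x => chartOneForm l x z) y z' = _ := key z z'
  rw [← h1, ← h2, sub_eq_add_neg]
  congr 1
  · exact one_smul _ _
  · exact neg_one_smul ℤ _

end TwoForm

/-! ### Involutivity of `ker Ω_L`, and `𝒢` as the kernel of the Hessian. -/

section Kernel

theorem alternating_two_swap {E F : Type*} [NormedAddCommGroup E] [NormedSpace ℝ E]
    [NormedAddCommGroup F] [NormedSpace ℝ F] (B : E [⋀^Fin 2]→L[ℝ] F) (a b : E) :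
    B ![a, b] = -B ![b, a] := by
  have h := B.toAlternatingMap.map_swap ![b, a] (i := 0) (j := 1) (by decide)
  have e : (![b, a] ∘ Equiv.swap (0 : Fin 2) 1) = ![a, b] := by
    funext i; fin_cases i <;> rfl
  rw [e] at h
  exact h

/-- The kernel of a closed two-form is closed under Lie brackets. -/
theorem closed_form_lieBracket {E : Type*} [NormedAddCommGroup E] [NormedSpace ℝ E]
    {B : E → E [⋀^Fin 2]→L[ℝ] ℝ} {V W : E → E} {y : E} (hB : DifferentiableAt ℝ B y)
    (hV : DifferentiableAt ℝ V y) (hW : DifferentiableAt ℝ W y) (hd : extDeriv B y = 0)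
    (hkV : ∀ᶠ x in 𝓝 y, ∀ z, B x ![V x, z] = 0) (hkW : ∀ᶠ x in 𝓝 y, ∀ z, B x ![W x, z] = 0)
    (z : E) : B y ![VectorField.lieBracket ℝ V W y, z] = 0 := by
  -- The invariant formula for `dB(V, W, z)` with `z` constant. Since `V` and `W` lie in the kernel
  -- near `y`, every term except `B([V, W], z)` vanishes.
  have h := extDeriv_apply_vectorField (V := ![V, W, fun _ => z]) hB
    (by intro i; fin_cases i; exacts [hV, hW, differentiableAt_const _])
  rw [hd, Fin.sum_univ_three] at h
  have e0 : (fun x => B x (Fin.removeNth 0 fun i => (![V, W, fun _ => z] : Fin 3 → E → E) i x))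
      =ᶠ[𝓝 y] fun _ => 0 := by
    filter_upwards [hkW] with x hx
    rw [← hx z]
    congr 1
    funext i; fin_cases i <;> rfl
  have e1 : (fun x => B x (Fin.removeNth 1 fun i => (![V, W, fun _ => z] : Fin 3 → E → E) i x))
      =ᶠ[𝓝 y] fun _ => 0 := by
    filter_upwards [hkV] with x hx
    rw [← hx z]
    congr 1
    funext i; fin_cases i <;> rfl
  have e2 : (fun x => B x (Fin.removeNth 2 fun i => (![V, W, fun _ => z] : Fin 3 → E → E) i x))
      =ᶠ[𝓝 y] fun _ => 0 := by
    filter_upwards [hkV] with x hx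
    rw [← hx (W x)]
    congr 1
    funext i; fin_cases i <;> rfl
  rw [e0.fderiv_eq, e1.fderiv_eq, e2.fderiv_eq] at h
  have f2 : ∀ f : Fin 2 → ℝ, ∑ j ≥ (0 : Fin 2), f j = f 0 + f 1 := fun f => by
    rw [show (Finset.Ici (0 : Fin 2)) = {0, 1} by decide]; simp
  have f1 : ∀ f : Fin 2 → ℝ, ∑ j ≥ (1 : Fin 2), f j = f 1 := fun f => by
    rw [show (Finset.Ici (1 : Fin 2)) = {1} by decide]; simp
  have f3 : ∀ f : Fin 2 → Fin 2 → ℝ, ∑ i, ∑ j ≥ i, f i j = f 0 0 + f 0 1 + f 1 1 := fun f => by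
    rw [Fin.sum_univ_two, f2, f1]
  have h' := h.trans (congrArg _ (f3 _))
  obtain ⟨β, hβ⟩ : ∃ β : E → E → ℝ, ∀ a b, B y ![a, b] = β a b := ⟨_, fun _ _ => rfl⟩
  have g0 : ∀ a : E, β a (W y) = 0 := fun a => by
    rw [← hβ, alternating_two_swap, hkW.self_of_nhds, neg_zero]
  have g1 : ∀ a : E, β a (V y) = 0 := fun a => by
    rw [← hβ, alternating_two_swap, hkV.self_of_nhds, neg_zero]
  have q : ∀ (a : E) (v : Fin 1 → E), B y (Matrix.vecCons a v) = β a (v 0) := by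
    intro a v
    rw [← hβ]
    congr 1
    funext i; fin_cases i <;> rfl
  rw [q, q, q] at h'
  have r0 := g0 (VectorField.lieBracket ℝ V (fun _ => z) y)
  have r1 := g1 (VectorField.lieBracket ℝ W (fun _ => z) y)
  have h2 : (0 : ℝ) = (-1 : ℤ) ^ 0 • fderiv ℝ (fun _ : E => (0 : ℝ)) y (V y) +
      (-1 : ℤ) ^ 1 • fderiv ℝ (fun _ : E => (0 : ℝ)) y (W y) +
      (-1 : ℤ) ^ 2 • fderiv ℝ (fun _ : E => (0 : ℝ)) y z -
      ((-1 : ℤ) ^ (0 + 0) • β (VectorField.lieBracket ℝ V W y) z +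
        (-1 : ℤ) ^ (0 + 1) • β (VectorField.lieBracket ℝ V (fun _ => z) y) (W y) +
        (-1 : ℤ) ^ (1 + 1) • β (VectorField.lieBracket ℝ W (fun _ => z) y) (V y)) := h'
  rw [r0, r1] at h2
  rw [hβ]
  simpa using h2

variable {D : ℕ} {Q : Type*} [TopologicalSpace Q] [ChartedSpace (Coord D) Q]
  [IsManifold (𝓡 D) ∞ Q]

theorem contDiffOn_extDeriv_oneFormInChart {L : Phase D Q → ℝ}
    (hL : ContMDiff (tModel D) 𝓘(ℝ, ℝ) ∞ L) (p : Phase D Q) :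
    ContDiffOn ℝ ∞ (extDeriv (oneFormInChart (lagrangeOneForm L) p))
      (extChartAt (tModel D) p).target := by
  have h := (contDiffOn_oneFormInChart hL p).fderiv_of_isOpen
    (isOpen_extChartAt_target p) (m := ∞) (by simp)
  exact (ContinuousAlternatingMap.alternatizeUncurryFinCLM ℝ (Coord D × Coord D)
    ℝ).contDiff.comp_contDiffOn h

/-- `ker Ω_L` is involutive. -/
theorem bracket_mem_kerOmega {L : Phase D Q → ℝ} (hL : ContMDiff (tModel D) 𝓘(ℝ, ℝ) ∞ L)
    {X Y : VField D Q} {U : Set (Phase D Q)} (hU : IsOpen U) (hX : SmoothFieldOn X U)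
    (hY : SmoothFieldOn Y U) (hkX : ∀ u ∈ U, X u ∈ kerOmega L u)
    (hkY : ∀ u ∈ U, Y u ∈ kerOmega L u) {u : Phase D Q} (hu : u ∈ U) :
    bracket X Y u ∈ kerOmega L u := by
  rw [mem_kerOmega_iff hL (mem_extChartAt_source u)]
  intro z
  have hO := (isOpen_target_inter_preimage (I := tModel D) u hU).mem_nhds
    (x := extChartAt (tModel D) u u) ⟨mem_extChartAt_target u, by rwa [mem_preimage, extChartAt_to_inv]⟩
  have hT := (isOpen_extChartAt_target (I := tModel D) u).mem_nhds (mem_extChartAt_target u)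
  have hk : ∀ X : VField D Q, (∀ u ∈ U, X u ∈ kerOmega L u) →
      ∀ᶠ y in 𝓝 (extChartAt (tModel D) u u), ∀ z,
        extDeriv (oneFormInChart (lagrangeOneForm L) u) y ![chartField (tModel D) u X y, z] = 0 := by
    intro X hkX
    filter_upwards [hO] with y hy z
    have h := (mem_kerOmega_iff hL ((extChartAt (tModel D) u).map_target hy.1) _).1 (hkX _ hy.2) z
    rw [(extChartAt (tModel D) u).right_inv hy.1] at h
    exact h
  have h := closed_form_lieBracket
    (((contDiffOn_extDeriv_oneFormInChart hL u).contDiffAt hT).differentiableAt (by simp))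
    (((contDiffOn_chartField hU hX u).contDiffAt hO).differentiableAt (by simp))
    (((contDiffOn_chartField hU hY u).contDiffAt hO).differentiableAt (by simp))
    (extDeriv_extDeriv_apply
      (contDiffAt_infty.1 ((contDiffOn_oneFormInChart hL u).contDiffAt hT) 2) (by simp))
    (hk X hkX) (hk Y hkY) z
  rw [← mfderiv_extChartAt_mlieBracket] at h
  exact h

theorem fderiv_fderiv_comp_inr {V W F : Type*} [NormedAddCommGroup V] [NormedSpace ℝ V]
    [NormedAddCommGroup W] [NormedSpace ℝ W] [NormedAddCommGroup F] [NormedSpace ℝ F]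
    {l : V × W → F} {q : V} {v : W} (hd : DifferentiableAt ℝ (fderiv ℝ l) (q, v)) (g a : W) :
    fderiv ℝ (fun w => (fderiv ℝ l (q, w)).comp (ContinuousLinearMap.inr ℝ V W)) v g a =
      fderiv ℝ (fderiv ℝ l) (q, v) (0, g) (0, a) := by
  have h2 := HasFDerivAt.comp (f := fun w : W => (q, w)) (g := fderiv ℝ l) v hd.hasFDerivAt
    (hasFDerivAt_prodMk_right (𝕜 := ℝ) q v)
  have h3 := h2.clm_comp (hasFDerivAt_const (ContinuousLinearMap.inr ℝ V W) _)
  refine (congrArg (fun A => A g a) h3.fderiv).trans ?_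
  simp

/-- The Hessian in the preferred chart. -/
theorem hessian_chart {L : Phase D Q → ℝ} (hL : ContMDiff (tModel D) 𝓘(ℝ, ℝ) ∞ L)
    (u : Phase D Q) (g a : Coord D) :
    hessian L u g a =
      fderiv ℝ (fderiv ℝ (L ∘ (extChartAt (tModel D) u).symm)) (extChartAt (tModel D) u u)
        (0, g) (0, a) := by
  set q := extChartAt (𝓡 D) u.proj u.proj with hq
  have hqs : (extChartAt (𝓡 D) u.proj).symm q = u.proj := extChartAt_to_inv u.proj
  have hT : ∀ w : Coord D, (q, w) ∈ (extChartAt (tModel D) u).target := fun w => by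
    rw [extChartAt_phase_target]; exact ⟨mem_extChartAt_target u.proj, mem_univ _⟩
  -- The base point is generalized to `b`, so that the equality with `u.proj` can be substituted in
  -- the dependent types.
  have hf : ∀ b : Q, b = u.proj → ∀ w : Coord D, (fibreMap u.proj b w : Coord D) = w := by
    rintro b rfl w
    rw [fibreMap_self]; rfl
  have hb : ∀ b : Q, b = u.proj → ∀ w : Coord D,
      (⟨b, fibreMap u.proj b w⟩ : Phase D Q) = ⟨u.proj, w⟩ := by
    rintro b rfl w
    rw [fibreMap_self]; rfl
  have hs : ∀ w : Coord D, (extChartAt (tModel D) u).symm (q, w) = ⟨u.proj, w⟩ := fun w =>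
    (extChartAt_phase_symm u (hT w)).trans (hb _ hqs w)
  have hu : extChartAt (tModel D) u u = (q, u.snd) := by
    have h := (extChartAt (tModel D) u).right_inv (hT u.snd)
    exact (congrArg (extChartAt (tModel D) u) (hs u.snd)).symm.trans h
  have hcong : ∀ {v v' : Phase D Q}, v = v' → ∀ {A A' : Coord D}, A = A' →
      fibreDeriv L v A = fibreDeriv L v' A' := by
    rintro v _ rfl A _ rfl; rfl
  have hF : (fun w : Coord D => (fibreDeriv L ⟨u.proj, w⟩ : Coord D →L[ℝ] ℝ)) = fun w =>
      (fderiv ℝ (L ∘ (extChartAt (tModel D) u).symm) (q, w)).comp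
        (ContinuousLinearMap.inr ℝ (Coord D) (Coord D)) := by
    funext w
    refine ContinuousLinearMap.ext fun a => ?_
    exact (hcong (hs w) (hf _ hqs a)).symm.trans (fibreDeriv_chart L hL u (hT w) a)
  have hd : DifferentiableAt ℝ (fderiv ℝ (L ∘ (extChartAt (tModel D) u).symm)) (q, u.snd) :=
    (((contDiffOn_lagrangian_chart hL u).fderiv_of_isOpen (isOpen_extChartAt_target u) (m := ∞)
      (by simp)).contDiffAt ((isOpen_extChartAt_target u).mem_nhds (hT u.snd))).differentiableAt
      (by simp)
  have h1 : hessian L u g a = fderiv ℝ (F := Coord D →L[ℝ] ℝ) (fun w : Coord D =>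
    (fibreDeriv L ⟨u.proj, w⟩ : Coord D →L[ℝ] ℝ)) u.snd g a := rfl
  rw [hu]
  exact h1.trans ((congrArg (fun F : Coord D → Coord D →L[ℝ] ℝ =>
    fderiv ℝ F (u.snd : Coord D) g a) hF).trans (fderiv_fderiv_comp_inr hd g a))

/-- The vertical lift of a tangent vector of `Q` at `u.proj`. -/
def vertLift (u : Phase D Q) : Coord D →ₗ[ℝ] TPhase u :=
  (ContinuousLinearMap.inverse (mfderiv (tModel D) 𝓘(ℝ, Coord D × Coord D)
    (extChartAt (tModel D) u) u)).toLinearMap.comp (LinearMap.inr ℝ (Coord D) (Coord D))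

/-- For the vertical vector with components `(0, g)`, contraction with `dθ_L` is the form `(M g)
dq`. So the vertical lift maps `ker M` isomorphically onto `𝒢`. -/
theorem finrank_vertKer {L : Phase D Q → ℝ} (hL : ContMDiff (tModel D) 𝓘(ℝ, ℝ) ∞ L)
    (u : Phase D Q) :
    Module.finrank ℝ (vertKer L u) = Module.finrank ℝ (LinearMap.ker (hessian L u).toLinearMap) := by
  have hu := mem_extChartAt_source (I := tModel D) u
  have hi := isInvertible_mfderiv_extChartAt (I := tModel D) hu
  have hl : ContDiffAt ℝ 2 (L ∘ (extChartAt (tModel D) u).symm) (extChartAt (tModel D) u u) :=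
    contDiffAt_infty.1 ((contDiffOn_lagrangian_chart hL u).contDiffAt
      ((isOpen_extChartAt_target u).mem_nhds (mem_extChartAt_target u))) 2
  have hev : oneFormInChart (lagrangeOneForm L) u =ᶠ[𝓝 (extChartAt (tModel D) u u)] fun y =>
      ContinuousAlternatingMap.ofSubsingleton ℝ (Coord D × Coord D) ℝ (0 : Fin 1)
        (chartOneForm (L ∘ (extChartAt (tModel D) u).symm) y) := by
    filter_upwards [(isOpen_extChartAt_target (I := tModel D) u).mem_nhds
      (mem_extChartAt_target u)] with y hy using oneFormInChart_eq L hL u hy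
  have hlift : ∀ g : Coord D, mfderiv (tModel D) 𝓘(ℝ, Coord D × Coord D) (extChartAt (tModel D) u) u
      (vertLift u g) = ((0, g) : Coord D × Coord D) := fun g => hi.self_apply_inverse _
  have hinj : Function.Injective (vertLift u) := by
    intro g g' h
    have h1 := (hlift g).symm.trans ((congrArg _ h).trans (hlift g'))
    exact (Prod.mk.inj h1).2
  have hker : ∀ g : Coord D, vertLift u g ∈ kerOmega L u ↔
      g ∈ LinearMap.ker (hessian L u).toLinearMap := by
    intro g
    rw [mem_kerOmega_iff hL hu, hev.extDeriv_eq]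
    have key : ∀ z : Coord D × Coord D, extDeriv (fun y =>
        ContinuousAlternatingMap.ofSubsingleton ℝ (Coord D × Coord D) ℝ (0 : Fin 1)
        (chartOneForm (L ∘ (extChartAt (tModel D) u).symm) y)) (extChartAt (tModel D) u u)
        ![mfderiv (tModel D) 𝓘(ℝ, Coord D × Coord D) (extChartAt (tModel D) u) u
          (vertLift u g), z] = hessian L u g z.1 := by
      intro z
      rw [hlift, extDeriv_ofSubsingleton_chartOneForm hl, hessian_chart hL]
      have : (((0 : Coord D), (0 : Coord D))) = 0 := rfl
      simp [this]
    constructor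
    · intro h
      change hessian L u g = 0
      refine ContinuousLinearMap.ext fun a => ?_
      exact (key (a, 0)).symm.trans (h (a, 0))
    · intro h z
      rw [key z]
      exact congrArg (fun A : Coord D →L[ℝ] ℝ => A z.1) h
  let K : Submodule ℝ (Coord D) := LinearMap.ker (hessian L u).toLinearMap
  have hmap : vertKer L u = K.map (vertLift u) := by
    ext X
    constructor
    · rintro ⟨hv, hk⟩
      have hv := (mem_vertical_iff u hu X).1 hv
      refine ⟨(mfderiv (tModel D) 𝓘(ℝ, Coord D × Coord D) (extChartAt (tModel D) u) u X).2, ?_⟩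
      have hX : vertLift u
          (mfderiv (tModel D) 𝓘(ℝ, Coord D × Coord D) (extChartAt (tModel D) u) u X).2 = X := by
        apply hi.injective
        rw [hlift]
        exact Prod.ext hv.symm rfl
      refine ⟨(hker _).1 ?_, hX⟩
      rwa [hX]
    · rintro ⟨g, hg, rfl⟩
      refine ⟨(mem_vertical_iff u hu _).2 ?_, (hker g).2 hg⟩
      rw [hlift]
  rw [hmap]
  exact (LinearEquiv.finrank_eq (Submodule.equivMapOfInjective (vertLift u) hinj K)).symm

end Kernel

/-! ### Smooth local bases of `ker Ω_L` adapted to `𝒢`. -/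

section Frames

theorem isBasisOf_of_card {ι V : Type*} [Fintype ι] [AddCommGroup V] [Module ℝ V]
    {b : ι → V} {S : Submodule ℝ V} [FiniteDimensional ℝ S] (hb : LinearIndependent ℝ b)
    (hS : ∀ i, b i ∈ S) (hc : Module.finrank ℝ S = Fintype.card ι) : IsBasisOf b S :=
  ⟨hb, Submodule.eq_of_le_of_finrank_eq (Submodule.span_le.2 (by rintro _ ⟨i, rfl⟩; exact hS i))
    ((finrank_span_eq_card hb).trans hc.symm)⟩

/-- A right inverse of `A` onto its range, extended linearly to the whole target. -/
theorem exists_generalized_inverse {E F : Type*} [AddCommGroup E] [Module ℝ E] [AddCommGroup F]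
    [Module ℝ F] (A : E →ₗ[ℝ] F) : ∃ g : F →ₗ[ℝ] E, ∀ e, A (g (A e)) = A e := by
  obtain ⟨h, hh⟩ := LinearMap.exists_rightInverse_of_surjective A.rangeRestrict
    (LinearMap.range_rangeRestrict A)
  obtain ⟨g, hg⟩ := LinearMap.exists_extend h
  refine ⟨g, fun e => ?_⟩
  have h1 : g (A e) = h (A.rangeRestrict e) := congrArg (fun f => f (A.rangeRestrict e)) hg
  have h2 := congrArg (fun f => f (A.rangeRestrict e)) hh
  rw [h1]
  exact congrArg Subtype.val h2

/-- Vectors in the kernel at a point of a smooth family of linear maps of constant rank extend to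
smooth sections of the kernel. -/
theorem exists_kernel_sections {Y E F ι : Type*} [NormedAddCommGroup Y] [NormedSpace ℝ Y]
    [NormedAddCommGroup E] [NormedSpace ℝ E] [FiniteDimensional ℝ E] [NormedAddCommGroup F]
    [NormedSpace ℝ F] [FiniteDimensional ℝ F] {A : Y → E →L[ℝ] F} {O : Set Y} (hO : IsOpen O)
    (hA : ContDiffOn ℝ ∞ A O) {r : ℕ}
    (hr : ∀ y ∈ O, Module.finrank ℝ (LinearMap.ker (A y).toLinearMap) = r) {y₀ : Y} (hy₀ : y₀ ∈ O)
    (b : ι → E) (hb : ∀ i, A y₀ (b i) = 0) :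
    ∃ O' ⊆ O, IsOpen O' ∧ y₀ ∈ O' ∧ ∃ k : ι → Y → E, (∀ i, ContDiffOn ℝ ∞ (k i) O') ∧
      (∀ i, k i y₀ = b i) ∧ ∀ i, ∀ y ∈ O', A y (k i y) = 0 := by
  have : CompleteSpace E := FiniteDimensional.complete ℝ E
  obtain ⟨g, hg⟩ := exists_generalized_inverse (A y₀).toLinearMap
  let g' : F →L[ℝ] E := g.toContinuousLinearMap
  -- On `ker (A y)` this is `1 - g ∘ A y₀`, whose values lie in `ker (A y₀)`. It is the identity at
  -- `y₀`, hence invertible nearby, and its inverse carries the `b i` back.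
  let Φ : Y → E →L[ℝ] E := fun y => ContinuousLinearMap.id ℝ E + g'.comp (A y - A y₀)
  have hΦ : ContDiffOn ℝ ∞ Φ O :=
    contDiffOn_const.add (contDiffOn_const.clm_comp (hA.sub contDiffOn_const))
  have hΦ0 : Φ y₀ = (ContinuousLinearEquiv.refl ℝ E : E →L[ℝ] E) := by
    ext e; simp [Φ]
  have hmap : ∀ y, ∀ e, A y e = 0 → A y₀ (Φ y e) = 0 := by
    intro y e he
    have h1 : A y₀ (g (A y₀ e)) = A y₀ e := hg e
    have h2 : Φ y e = e - g (A y₀ e) := by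
      simp [Φ, g', he, sub_eq_add_neg]
    rw [h2, map_sub, h1, sub_self]
  refine ⟨O ∩ Φ ⁻¹' range ((↑) : (E ≃L[ℝ] E) → E →L[ℝ] E), inter_subset_left,
    hΦ.continuousOn.isOpen_inter_preimage hO ContinuousLinearEquiv.isOpen,
    ⟨hy₀, ContinuousLinearEquiv.refl ℝ E, hΦ0.symm⟩, fun i y => (Φ y).inverse (b i), ?_, ?_, ?_⟩
  · intro i y hy
    obtain ⟨hyO, e, he⟩ := hy
    have h1 : ContDiffAt ℝ ∞ Φ y := hΦ.contDiffAt (hO.mem_nhds hyO)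
    have h2 : ContDiffAt ℝ ∞ ContinuousLinearMap.inverse (Φ y) := by
      rw [← he]; exact contDiffAt_map_inverse e
    exact ((h2.comp y h1).clm_apply contDiffAt_const).contDiffWithinAt
  · intro i
    change (Φ y₀).inverse (b i) = b i
    rw [hΦ0, ContinuousLinearMap.inverse_equiv]
    rfl
  · rintro i y ⟨hyO, e, he⟩
    change A y ((Φ y).inverse (b i)) = 0
    have hle : (LinearMap.ker (A y).toLinearMap).map (e : E →ₗ[ℝ] E) ≤
        LinearMap.ker (A y₀).toLinearMap := by
      rintro _ ⟨x, hx, rfl⟩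
      have := hmap y x hx
      rw [← he] at this
      exact this
    -- Constant rank enters here: an injection between kernels of equal dimension is onto.
    have heq := Submodule.eq_of_le_of_finrank_eq hle
      ((LinearEquiv.finrank_map_eq e.toLinearEquiv _).trans ((hr y hyO).trans (hr y₀ hy₀).symm))
    obtain ⟨x, hx, hxb⟩ : b i ∈ (LinearMap.ker (A y).toLinearMap).map (e : E →ₗ[ℝ] E) := by
      rw [heq]; exact hb i
    rw [← he, ContinuousLinearMap.inverse_equiv, ← hxb]
    have : e.symm (e x) = x := e.symm_apply_apply x
    exact (congrArg (A y) this).trans hx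

/-- A basis of a subspace, extended to a basis of a larger subspace. -/
theorem exists_adapted_basis {E : Type*} [AddCommGroup E] [Module ℝ E] [FiniteDimensional ℝ E]
    {S T : Submodule ℝ E} (h : S ≤ T) {r s : ℕ} (hS : Module.finrank ℝ S = s)
    (hT : Module.finrank ℝ T = s + r) :
    ∃ (k : Fin r → E) (g : Fin s → E), LinearIndependent ℝ (Sum.elim k g) ∧
      (∀ i, k i ∈ T) ∧ ∀ i, g i ∈ S := by
  obtain ⟨C, hC⟩ := S.exists_isCompl
  have h1 : S ⊔ C ⊓ T = T := by
    rw [← sup_inf_assoc_of_le C h, hC.sup_eq_top, top_inf_eq]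
  have hd : Disjoint S (C ⊓ T) := hC.disjoint.mono_right inf_le_left
  have h2 : Module.finrank ℝ ↥(C ⊓ T) = r := by
    have := Submodule.finrank_sup_add_finrank_inf_eq S (C ⊓ T)
    rw [h1, hd.eq_bot, finrank_bot, hS, hT] at this
    omega
  let bk := Module.finBasisOfFinrankEq ℝ ↥(C ⊓ T) h2
  let bg := Module.finBasisOfFinrankEq ℝ S hS
  refine ⟨fun i => bk i, fun i => bg i, LinearIndependent.sum_type ?_ ?_ ?_,
    fun i => (bk i).2.2, fun i => (bg i).2⟩
  · exact bk.linearIndependent.map' (C ⊓ T).subtype (Submodule.ker_subtype _)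
  · exact bg.linearIndependent.map' S.subtype (Submodule.ker_subtype _)
  · refine hd.symm.mono (Submodule.span_le.2 ?_) (Submodule.span_le.2 ?_)
    · rintro _ ⟨i, rfl⟩; exact (bk i).2
    · rintro _ ⟨i, rfl⟩; exact (bg i).2

variable {D : ℕ} {Q : Type*} [TopologicalSpace Q] [ChartedSpace (Coord D) Q]
  [IsManifold (𝓡 D) ∞ Q]

instance finiteDimensional_tangentSpace_phase (u : Phase D Q) : FiniteDimensional ℝ (TPhase u) :=
  inferInstanceAs (FiniteDimensional ℝ (Coord D × Coord D))

/-- The vector field on `TQ` with coordinate expression `k` in the chart at `p`. -/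
def liftField (p : Phase D Q) (k : Coord D × Coord D → Coord D × Coord D) : VField D Q := fun u =>
  (mfderiv (tModel D) 𝓘(ℝ, Coord D × Coord D) (extChartAt (tModel D) p) u).inverse
    (k (extChartAt (tModel D) p u))

theorem mfderiv_liftField {p u : Phase D Q} (hu : u ∈ (extChartAt (tModel D) p).source)
    (k : Coord D × Coord D → Coord D × Coord D) :
    mfderiv (tModel D) 𝓘(ℝ, Coord D × Coord D) (extChartAt (tModel D) p) u (liftField p k u) =
      k (extChartAt (tModel D) p u) :=
  (isInvertible_mfderiv_extChartAt hu).self_apply_inverse _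

theorem smoothFieldOn_liftField {p : Phase D Q} {k : Coord D × Coord D → Coord D × Coord D}
    {O : Set (Coord D × Coord D)} (hO : IsOpen O) (hk : ContDiffOn ℝ ∞ k O) :
    SmoothFieldOn (liftField p k)
      ((extChartAt (tModel D) p).source ∩ extChartAt (tModel D) p ⁻¹' O) := by
  intro u hu
  have hc : ContMDiffAt (tModel D) 𝓘(ℝ, Coord D × Coord D) ∞ (extChartAt (tModel D) p) u :=
    contMDiffAt_extChartAt' (by have := hu.1; rwa [extChartAt_source] at this)
  have hV : ContMDiffAt 𝓘(ℝ, Coord D × Coord D) 𝓘(ℝ, Coord D × Coord D).tangent ∞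
      (fun y => (⟨y, k y⟩ : TangentBundle 𝓘(ℝ, Coord D × Coord D) (Coord D × Coord D)))
      (extChartAt (tModel D) p u) :=
    contMDiffAt_vectorSpace_iff_contDiffAt.2 (hk.contDiffAt (hO.mem_nhds hu.2))
  exact (ContMDiffAt.mpullback_vectorField_preimage hV hc
    (isInvertible_mfderiv_extChartAt hu.1) (by simp)).contMDiffWithinAt

/-- The two-form `dθ_L` in the chart at `p`, as a map to the dual space. -/
def chartKernelMap (L : Phase D Q → ℝ) (p : Phase D Q) (y : Coord D × Coord D) :
    Coord D × Coord D →L[ℝ] Coord D × Coord D →L[ℝ] ℝ :=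
  ((ContinuousAlternatingMap.ofSubsingletonLIE (𝕜 := ℝ) (E := Coord D × Coord D) (F := ℝ)
    (0 : Fin 1)).symm.toContinuousLinearEquiv :
      (Coord D × Coord D) [⋀^Fin 1]→L[ℝ] ℝ →L[ℝ] Coord D × Coord D →L[ℝ] ℝ).comp
    (extDeriv (oneFormInChart (lagrangeOneForm L) p) y).curryLeft

theorem chartKernelMap_apply (L : Phase D Q → ℝ) (p : Phase D Q) (y z z' : Coord D × Coord D) :
    chartKernelMap L p y z z' = extDeriv (oneFormInChart (lagrangeOneForm L) p) y ![z, z'] := by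
  refine congrArg (extDeriv (oneFormInChart (lagrangeOneForm L) p) y) ?_
  funext i; fin_cases i <;> rfl

theorem contDiffOn_chartKernelMap {L : Phase D Q → ℝ} (hL : ContMDiff (tModel D) 𝓘(ℝ, ℝ) ∞ L)
    (p : Phase D Q) : ContDiffOn ℝ ∞ (chartKernelMap L p) (extChartAt (tModel D) p).target := by
  have hc := LinearIsometry.contDiff (𝕜 := ℝ) (n := ∞)
    (E := (Coord D × Coord D) [⋀^Fin (1 + 1)]→L[ℝ] ℝ)
    (F := Coord D × Coord D →L[ℝ] (Coord D × Coord D) [⋀^Fin 1]→L[ℝ] ℝ)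
    (ContinuousAlternatingMap.curryLeftLI (𝕜 := ℝ) (E := Coord D × Coord D) (F := ℝ) (n := 1))
  have h := hc.comp_contDiffOn (contDiffOn_extDeriv_oneFormInChart hL p)
  exact contDiffOn_const.clm_comp h

theorem mem_kerOmega_iff_chartKernelMap {L : Phase D Q → ℝ}
    (hL : ContMDiff (tModel D) 𝓘(ℝ, ℝ) ∞ L)
    {p u : Phase D Q} (hu : u ∈ (extChartAt (tModel D) p).source) (X : TPhase u) :
    X ∈ kerOmega L u ↔ chartKernelMap L p (extChartAt (tModel D) p u)
      (mfderiv (tModel D) 𝓘(ℝ, Coord D × Coord D) (extChartAt (tModel D) p) u X) = 0 := by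
  rw [mem_kerOmega_iff hL hu]
  constructor
  · intro h
    refine ContinuousLinearMap.ext fun z => ?_
    exact (chartKernelMap_apply L p _ _ z).trans (h z)
  · intro h z
    exact (chartKernelMap_apply L p _ _ z).symm.trans
      (congrArg (fun A : Coord D × Coord D →L[ℝ] ℝ => A z) h)

theorem finrank_eq_of_chart {p u : Phase D Q} (hu : u ∈ (extChartAt (tModel D) p).source)
    {S : Submodule ℝ (TPhase u)} {T : Submodule ℝ (Coord D × Coord D)}
    (h : ∀ X : TPhase u, X ∈ S ↔
      mfderiv (tModel D) 𝓘(ℝ, Coord D × Coord D) (extChartAt (tModel D) p) u X ∈ T) :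
    Module.finrank ℝ T = Module.finrank ℝ S := by
  obtain ⟨e, he⟩ : ∃ e : TPhase u ≃L[ℝ] Coord D × Coord D, ∀ X,
      e X = mfderiv (tModel D) 𝓘(ℝ, Coord D × Coord D) (extChartAt (tModel D) p) u X := by
    obtain ⟨e, he⟩ := isInvertible_mfderiv_extChartAt (I := tModel D) hu
    exact ⟨e, fun X => congrArg (fun A => A X) he⟩
  have h : ∀ X : TPhase u, X ∈ S ↔ e X ∈ T := fun X =>
    (h X).trans (Iff.of_eq (congrArg (· ∈ T) (he X).symm))
  have hmap : S.map (e.toLinearEquiv : TPhase u →ₗ[ℝ] Coord D × Coord D) = T := by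
    ext z
    constructor
    · rintro ⟨X, hX, rfl⟩; exact (h X).1 hX
    · intro hz
      refine ⟨e.symm z, (h _).2 ?_, e.apply_symm_apply z⟩
      have : e (e.symm z) = z := e.apply_symm_apply z
      exact this.symm ▸ hz
  rw [← hmap]
  exact LinearEquiv.finrank_map_eq e.toLinearEquiv S

/-- Sections of `ker Ω_L` and of `𝒢` extend an adapted basis at `p`. They stay independent nearby
because independence is an open condition, and then span by dimension. -/
theorem exists_isKerBasis {L : Phase D Q → ℝ} (hL : ContMDiff (tModel D) 𝓘(ℝ, ℝ) ∞ L) {N₀ Dbar : ℕ}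
    (hV : ∀ u, Module.finrank ℝ (vertKer L u) = N₀)
    (hΩ : ∀ u, Module.finrank ℝ (kerOmega L u) = N₀ + Dbar) (p : Phase D Q) :
    ∃ W : Set (Phase D Q), IsOpen W ∧ p ∈ W ∧ ∃ (K : Fin Dbar → VField D Q)
      (G : Fin N₀ → VField D Q), IsKerBasis L W K G := by
  set c := extChartAt (tModel D) p with hc
  set O := c.target with hO
  have hOo : IsOpen O := isOpen_extChartAt_target p
  have hp := mem_extChartAt_source (I := tModel D) p
  let A := chartKernelMap L p
  -- Pairing the form with the horizontal projection exhibits `𝒢` as a kernel too.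
  let A' : Coord D × Coord D → Coord D × Coord D →L[ℝ] (Coord D × Coord D →L[ℝ] ℝ) × Coord D :=
    fun y => (A y).prod (ContinuousLinearMap.fst ℝ (Coord D) (Coord D))
  have hA : ContDiffOn ℝ ∞ A O := contDiffOn_chartKernelMap hL p
  have hA' : ContDiffOn ℝ ∞ A' O := by
    have h : ContDiffOn ℝ ∞ (fun y =>
        (ContinuousLinearMap.inl ℝ (Coord D × Coord D →L[ℝ] ℝ) (Coord D)).comp (A y) +
        (ContinuousLinearMap.inr ℝ (Coord D × Coord D →L[ℝ] ℝ) (Coord D)).comp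
          (ContinuousLinearMap.fst ℝ (Coord D) (Coord D))) O :=
      (contDiffOn_const.clm_comp hA).add contDiffOn_const
    refine h.congr fun y _ => ContinuousLinearMap.ext fun z => ?_
    exact Prod.ext (add_zero (A y z)).symm (zero_add z.1).symm
  have hkA : ∀ {u : Phase D Q}, u ∈ c.source → ∀ X : TPhase u, X ∈ kerOmega L u ↔
      mfderiv (tModel D) 𝓘(ℝ, Coord D × Coord D) c u X ∈
        LinearMap.ker (A (c u)).toLinearMap := fun hu X =>
    mem_kerOmega_iff_chartKernelMap hL hu X
  have hkA' : ∀ {u : Phase D Q}, u ∈ c.source → ∀ X : TPhase u, X ∈ vertKer L u ↔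
      mfderiv (tModel D) 𝓘(ℝ, Coord D × Coord D) c u X ∈
        LinearMap.ker (A' (c u)).toLinearMap := by
    intro u hu X
    have h1 := mem_vertical_iff p hu X
    have h2 := hkA hu X
    constructor
    · rintro ⟨hv, hk⟩
      exact Prod.ext (h2.1 hk) (h1.1 hv)
    · intro h
      exact ⟨h1.2 (congrArg Prod.snd h), h2.2 (congrArg Prod.fst h)⟩
  have hrA : ∀ y ∈ O, Module.finrank ℝ (LinearMap.ker (A y).toLinearMap) = N₀ + Dbar := by
    intro y hy
    have h := finrank_eq_of_chart (c.map_target hy) (hkA (c.map_target hy))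
    rw [c.right_inv hy, hΩ] at h
    exact h
  have hrA' : ∀ y ∈ O, Module.finrank ℝ (LinearMap.ker (A' y).toLinearMap) = N₀ := by
    intro y hy
    have h := finrank_eq_of_chart (c.map_target hy) (hkA' (c.map_target hy))
    rw [c.right_inv hy, hV] at h
    exact h
  have hp' : c p ∈ O := c.map_source hp
  obtain ⟨k₀, g₀, hli, hk₀, hg₀⟩ := exists_adapted_basis
    (S := LinearMap.ker (A' (c p)).toLinearMap) (T := LinearMap.ker (A (c p)).toLinearMap)
    (fun x hx => congrArg Prod.fst (hx : A' (c p) x = 0)) (hrA' _ hp') (hrA _ hp')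
  obtain ⟨O₁, hO₁O, hO₁, hp₁, k, hkd, hk0, hkk⟩ := exists_kernel_sections hOo hA hrA hp' k₀ hk₀
  obtain ⟨O₂, hO₂O, hO₂, hp₂, g, hgd, hg0, hgk⟩ := exists_kernel_sections hOo hA' hrA' hp' g₀ hg₀
  let f : Coord D × Coord D → (Fin Dbar ⊕ Fin N₀ → Coord D × Coord D) := fun y =>
    Sum.elim (fun i => k i y) (fun i => g i y)
  have hf : ContinuousOn f (O₁ ∩ O₂) := by
    refine continuousOn_pi.2 ?_
    rintro (i | i)
    · exact (hkd i).continuousOn.mono inter_subset_left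
    · exact (hgd i).continuousOn.mono inter_subset_right
  let O₃ := (O₁ ∩ O₂) ∩ f ⁻¹' {b | LinearIndependent ℝ b}
  have hO₃ : IsOpen O₃ :=
    hf.isOpen_inter_preimage (hO₁.inter hO₂) isOpen_setOfPred_linearIndependent
  have hp₃ : c p ∈ O₃ := by
    refine ⟨⟨hp₁, hp₂⟩, ?_⟩
    have : f (c p) = Sum.elim k₀ g₀ := by
      funext i; rcases i with i | i
      exacts [hk0 i, hg0 i]
    rw [mem_preimage, this]
    exact hli
  have hsub : ∀ {u : Phase D Q}, u ∈ c.source ∩ c ⁻¹' O₃ → LinearIndependent ℝ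
      (Sum.elim (fun n => liftField p (k n) u) (fun m => liftField p (g m) u)) := by
    intro u hu
    have h : LinearIndependent ℝ (f (c u)) := hu.2.2
    have e : f (c u) = mfderiv (tModel D) 𝓘(ℝ, Coord D × Coord D) c u ∘
        (Sum.elim (fun n => liftField p (k n) u) (fun m => liftField p (g m) u)) := by
      funext i; rcases i with i | i
      exacts [(mfderiv_liftField hu.1 _).symm, (mfderiv_liftField hu.1 _).symm]
    rw [e] at h
    exact LinearIndependent.of_comp
      (mfderiv (tModel D) 𝓘(ℝ, Coord D × Coord D) c u).toLinearMap h
  have hmK : ∀ {u : Phase D Q}, u ∈ c.source ∩ c ⁻¹' O₃ → ∀ n,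
      liftField p (k n) u ∈ kerOmega L u := fun hu n => by
    rw [hkA hu.1, mfderiv_liftField hu.1]
    exact hkk n _ hu.2.1.1
  have hmG : ∀ {u : Phase D Q}, u ∈ c.source ∩ c ⁻¹' O₃ → ∀ n,
      liftField p (g n) u ∈ vertKer L u := fun hu n => by
    rw [hkA' hu.1, mfderiv_liftField hu.1]
    exact hgk n _ hu.2.1.2
  refine ⟨c.source ∩ c ⁻¹' O₃,
    (continuousOn_extChartAt p).isOpen_inter_preimage (isOpen_extChartAt_source p) hO₃,
    ⟨hp, hp₃⟩, fun n => liftField p (k n), fun m => liftField p (g m), ?_, ?_, ?_, ?_⟩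
  · exact fun n => smoothFieldOn_liftField hO₃ ((hkd n).mono fun y hy => hy.1.1)
  · exact fun n => smoothFieldOn_liftField hO₃ ((hgd n).mono fun y hy => hy.1.2)
  · intro u hu
    refine isBasisOf_of_card ?_ (hmG hu) (by rw [hV, Fintype.card_fin])
    exact (hsub hu).comp Sum.inr Sum.inr_injective
  · intro u hu
    refine isBasisOf_of_card (hsub hu) ?_ (by
      rw [hΩ, Fintype.card_sum, Fintype.card_fin, Fintype.card_fin, add_comm])
    rintro (i | i)
    · exact hmK hu i
    · exact (hmG hu i).2

end Frames

/-! ### Derivatives along fields on `TQ`, and functions of the base coordinates. -/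

section ReducedKernel

variable {D : ℕ} {Q : Type*} [TopologicalSpace Q] [ChartedSpace (Coord D) Q]
  [IsManifold (𝓡 D) ∞ Q]

theorem SmoothFunOn.det {n : ℕ} {A : Phase D Q → Matrix (Fin n) (Fin n) ℝ} {U : Set (Phase D Q)}
    (hA : ∀ i j, SmoothFunOn (fun u => A u i j) U) : SmoothFunOn (fun u => (A u).det) U := by
  unfold SmoothFunOn
  simp only [Matrix.det_apply, Units.smul_def, zsmul_eq_mul]
  exact contMDiffOn_finsetSum fun σ _ =>
    contMDiffOn_const.mul (contMDiffOn_finsetProd fun i _ => hA _ _)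

theorem SmoothFunOn.matrix_inv {n : ℕ} {A : Phase D Q → Matrix (Fin n) (Fin n) ℝ}
    {U : Set (Phase D Q)} (hA : ∀ i j, SmoothFunOn (fun u => A u i j) U)
    (hdet : ∀ u ∈ U, (A u).det ≠ 0) (i j : Fin n) : SmoothFunOn (fun u => (A u)⁻¹ i j) U := by
  have h1 : SmoothFunOn (fun u => ((A u).det)⁻¹ * (A u).adjugate i j) U := by
    refine ContMDiffOn.mul ((SmoothFunOn.det hA).inv₀ hdet) ?_
    simp only [Matrix.adjugate_apply]
    refine SmoothFunOn.det fun a b => ?_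
    by_cases h : a = j
    · subst h
      simp only [Matrix.updateRow_self]
      exact contMDiffOn_const
    · simp only [Matrix.updateRow_ne h]
      exact hA a b
  refine h1.congr fun u hu => ?_
  rw [Matrix.inv_def, Ring.inverse_eq_inv']
  rfl

theorem smoothFunOn_dirDeriv {X : VField D Q} {f : Phase D Q → ℝ} {U : Set (Phase D Q)}
    (hU : IsOpen U) (hX : SmoothFieldOn X U) (hf : SmoothFunOn f U) :
    SmoothFunOn (dirDeriv X f) U :=
  contMDiffOn_mvfderiv_apply hU hf hX

theorem dirDeriv_bracket {X Y : VField D Q} {f : Phase D Q → ℝ} {U : Set (Phase D Q)}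
    (hU : IsOpen U) (hX : SmoothFieldOn X U) (hY : SmoothFieldOn Y U) (hf : SmoothFunOn f U)
    {u : Phase D Q} (hu : u ∈ U) :
    mvfderiv (tModel D) f u (bracket X Y u) =
      dirDeriv X (dirDeriv Y f) u - dirDeriv Y (dirDeriv X f) u :=
  mvfderiv_mlieBracket hU hf hX hY hu

theorem dirDeriv_congr (X : VField D Q) {f g : Phase D Q → ℝ} {U : Set (Phase D Q)}
    (hU : IsOpen U) (h : ∀ u ∈ U, f u = g u) {u : Phase D Q} (hu : u ∈ U) :
    dirDeriv X f u = dirDeriv X g u := by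
  have hev : f =ᶠ[𝓝 u] g := by
    filter_upwards [hU.mem_nhds hu] with z hz using h z hz
  exact congrArg (fun A => A (X u)) (hev.mfderiv_eq (I := tModel D) (I' := 𝓘(ℝ, ℝ)))

theorem dirDeriv_const (X : VField D Q) (c : ℝ) (u : Phase D Q) :
    dirDeriv X (fun _ => c) u = 0 := by
  unfold dirDeriv
  rw [← mvfderivWithin_univ, mvfderivWithin_const]
  rfl

theorem dirDeriv_sum_mul {n : ℕ} (X : VField D Q) {f g : Fin n → Phase D Q → ℝ}
    {U : Set (Phase D Q)} (hU : IsOpen U) (hf : ∀ i, SmoothFunOn (f i) U)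
    (hg : ∀ i, SmoothFunOn (g i) U) {u : Phase D Q} (hu : u ∈ U) :
    dirDeriv X (fun z => ∑ i, f i z * g i z) u =
      ∑ i, (dirDeriv X (f i) u * g i u + f i u * dirDeriv X (g i) u) := by
  have hs := mem_extChartAt_source (I := tModel D) u
  have hmd : ∀ {f : Phase D Q → ℝ}, SmoothFunOn f U →
      MDifferentiableAt (tModel D) 𝓘(ℝ, ℝ) f u := fun hf =>
    (hf.contMDiffAt (hU.mem_nhds hu)).mdifferentiableAt (by simp)
  have hd : ∀ {f : Phase D Q → ℝ}, SmoothFunOn f U →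
      DifferentiableAt ℝ (f ∘ (extChartAt (tModel D) u).symm) (extChartAt (tModel D) u u) :=
    fun hf => ((contDiffOn_comp_extChartAt_symm hf u).contDiffAt
      ((isOpen_target_inter_preimage u hU).mem_nhds ⟨mem_extChartAt_target u, by
        rwa [mem_preimage, extChartAt_to_inv]⟩)).differentiableAt (by simp)
  have hsum : SmoothFunOn (fun z => ∑ i, f i z * g i z) U :=
    contMDiffOn_finsetSum fun i _ => (hf i).mul (hg i)
  have e : ∀ {f : Phase D Q → ℝ}, SmoothFunOn f U → dirDeriv X f u =
      fderiv ℝ (f ∘ (extChartAt (tModel D) u).symm) (extChartAt (tModel D) u u)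
        (chartField (tModel D) u X (extChartAt (tModel D) u u)) := fun hf =>
    mvfderiv_eq_fderiv_chartField u hs (hmd hf) X
  rw [e hsum]
  have e2 : (fun z => ∑ i, f i z * g i z) ∘ (extChartAt (tModel D) u).symm = fun y => ∑ i,
      (f i ∘ (extChartAt (tModel D) u).symm) y * (g i ∘ (extChartAt (tModel D) u).symm) y := rfl
  rw [e2, fderiv_fun_sum fun i _ => (hd (hf i)).fun_mul (hd (hg i)), sum_apply]
  refine Finset.sum_congr rfl fun i _ => ?_
  rw [fderiv_fun_mul (hd (hf i)) (hd (hg i)), e (hf i), e (hg i)]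
  have e3 : ∀ f : Phase D Q → ℝ,
      (f ∘ (extChartAt (tModel D) u).symm) (extChartAt (tModel D) u u) = f u := fun f => by
    rw [Function.comp_apply, extChartAt_to_inv]
  simp only [add_apply, smul_apply, smul_eq_mul, e3]
  ring

/-- The function `φ ∘ q` on `TQ`, where `q` denotes the base coordinates in the chart at `p`. -/
def baseFun {F : Type*} [NormedAddCommGroup F] [NormedSpace ℝ F] (p : Phase D Q)
    (φ : Coord D →L[ℝ] F) (u : Phase D Q) : F :=
  φ (extChartAt (tModel D) p u).1

theorem contMDiffOn_baseFun {F : Type*} [NormedAddCommGroup F] [NormedSpace ℝ F] (p : Phase D Q)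
    (φ : Coord D →L[ℝ] F) :
    ContMDiffOn (tModel D) 𝓘(ℝ, F) ∞ (baseFun p φ) (extChartAt (tModel D) p).source := by
  have hc : ContMDiffOn (tModel D) 𝓘(ℝ, Coord D × Coord D) ∞ (extChartAt (tModel D) p)
      (extChartAt (tModel D) p).source := by
    rw [extChartAt_source]; exact contMDiffOn_extChartAt
  exact (φ.comp (ContinuousLinearMap.fst ℝ (Coord D) (Coord D))).contMDiff.comp_contMDiffOn hc

theorem mvfderiv_baseFun {F : Type*} [NormedAddCommGroup F] [NormedSpace ℝ F] {p u : Phase D Q}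
    (φ : Coord D →L[ℝ] F) (hu : u ∈ (extChartAt (tModel D) p).source) (X : TPhase u) :
    mvfderiv (tModel D) (baseFun p φ) u X =
      φ (mfderiv (tModel D) 𝓘(ℝ, Coord D × Coord D) (extChartAt (tModel D) p) u X).1 := by
  have hc : MDifferentiableAt (tModel D) 𝓘(ℝ, Coord D × Coord D) (extChartAt (tModel D) p) u :=
    mdifferentiableAt_extChartAt (by rwa [extChartAt_source] at hu)
  let ψ := φ.comp (ContinuousLinearMap.fst ℝ (Coord D) (Coord D))
  have h := mfderiv_comp u (g := ψ) ψ.differentiableAt.mdifferentiableAt hc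
  rw [mfderiv_eq_fderiv, ψ.fderiv] at h
  exact congrArg (fun A => A X) h

theorem mvfderiv_baseFun_of_vertical {F : Type*} [NormedAddCommGroup F] [NormedSpace ℝ F]
    {p u : Phase D Q} (φ : Coord D →L[ℝ] F) (hu : u ∈ (extChartAt (tModel D) p).source)
    {X : TPhase u} (hX : X ∈ vertical u) : mvfderiv (tModel D) (baseFun p φ) u X = 0 := by
  rw [mvfderiv_baseFun φ hu]
  exact (congrArg φ ((mem_vertical_iff p hu X).1 hX)).trans (map_zero φ)

/-- The bracket of vertical vector fields is vertical. -/
theorem bracket_mem_vertical {X Y : VField D Q} {U : Set (Phase D Q)} (hU : IsOpen U)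
    (hX : SmoothFieldOn X U) (hY : SmoothFieldOn Y U) (hvX : ∀ u ∈ U, X u ∈ vertical u)
    (hvY : ∀ u ∈ U, Y u ∈ vertical u) {u : Phase D Q} (hu : u ∈ U) :
    bracket X Y u ∈ vertical u := by
  have hs := mem_extChartAt_source (I := tModel D) u
  have hO : IsOpen (U ∩ (extChartAt (tModel D) u).source) :=
    hU.inter (isOpen_extChartAt_source u)
  -- Vertical fields annihilate the base coordinates, so their commutator does as well.
  have hf := contMDiffOn_baseFun u (ContinuousLinearMap.id ℝ (Coord D))
  have h := mvfderiv_mlieBracket hO (hf.mono inter_subset_right) (hX.mono inter_subset_left)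
    (hY.mono inter_subset_left) ⟨hu, hs⟩
  have hz : ∀ {X : VField D Q}, (∀ u ∈ U, X u ∈ vertical u) →
      (fun z => mvfderiv (tModel D) (baseFun u (ContinuousLinearMap.id ℝ (Coord D))) z (X z))
        =ᶠ[𝓝 u] fun _ => 0 := by
    intro X hvX
    filter_upwards [hO.mem_nhds ⟨hu, hs⟩] with z hz
    exact mvfderiv_baseFun_of_vertical _ hz.2 (hvX z hz.1)
  have hz' : ∀ {f : Phase D Q → Coord D}, f =ᶠ[𝓝 u] (fun _ => 0) → ∀ Z : TPhase u,
      mvfderiv (tModel D) f u Z = 0 := by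
    intro f hf Z
    have h1 : mvfderiv (tModel D) f u Z = mvfderiv (tModel D) (fun _ => (0 : Coord D)) u Z :=
      congrArg (fun A => A Z) (hf.mfderiv_eq (I := tModel D) (I' := 𝓘(ℝ, Coord D)))
    rw [h1, ← mvfderivWithin_univ, mvfderivWithin_const]
    rfl
  rw [hz' (hz hvX), hz' (hz hvY), sub_zero] at h
  rw [mem_vertical_iff u hs]
  exact (mvfderiv_baseFun _ hs _).symm.trans h

end ReducedKernel

/-! ### Change of basis and the reduced kernel. -/

section CommonBasis

variable {D : ℕ} {Q : Type*} [TopologicalSpace Q] [ChartedSpace (Coord D) Q]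
  [IsManifold (𝓡 D) ∞ Q]

theorem IsKerBasis.mono {L : Phase D Q → ℝ} {U W : Set (Phase D Q)} {r s : ℕ}
    {K : Fin r → VField D Q} {G : Fin s → VField D Q} (h : IsKerBasis L W K G) (hUW : U ⊆ W) :
    IsKerBasis L U K G :=
  ⟨fun n => (h.smooth_K n).mono hUW, fun m => (h.smooth_G m).mono hUW,
    fun u hu => h.basis_vert u (hUW hu), fun u hu => h.basis_ker u (hUW hu)⟩

theorem IsBasisOf.mem {ι V : Type*} [AddCommGroup V] [Module ℝ V] {b : ι → V} {S : Submodule ℝ V}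
    (h : IsBasisOf b S) (i : ι) : b i ∈ S := by
  rw [← h.2]; exact Submodule.subset_span ⟨i, rfl⟩

theorem IsKerBasis.mem_vertKer {L : Phase D Q → ℝ} {U : Set (Phase D Q)} {r s : ℕ}
    {K : Fin r → VField D Q} {G : Fin s → VField D Q} (h : IsKerBasis L U K G) {u : Phase D Q}
    (hu : u ∈ U) (m : Fin s) : G m u ∈ vertKer L u :=
  (h.basis_vert u hu).mem m

theorem IsKerBasis.mem_kerOmega {L : Phase D Q → ℝ} {U : Set (Phase D Q)} {r s : ℕ}
    {K : Fin r → VField D Q} {G : Fin s → VField D Q} (h : IsKerBasis L U K G) {u : Phase D Q}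
    (hu : u ∈ U) (n : Fin r) : K n u ∈ kerOmega L u :=
  (h.basis_ker u hu).mem (Sum.inl n)

/-- The horizontal parts of a basis of `ker Ω_L` modulo `𝒢` are linearly independent. -/
theorem IsKerBasis.linearIndependent_base {L : Phase D Q → ℝ} {U : Set (Phase D Q)} {r s : ℕ}
    {K : Fin r → VField D Q} {G : Fin s → VField D Q} (h : IsKerBasis L U K G) {p u : Phase D Q}
    (hu : u ∈ U) (hs : u ∈ (extChartAt (tModel D) p).source) :
    LinearIndependent ℝ (fun m => mvfderiv (tModel D)
      (baseFun p (ContinuousLinearMap.id ℝ (Coord D))) u (K m u)) := by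
  obtain ⟨hK, -, hd⟩ := linearIndependent_sum.1 (h.basis_ker u hu).1
  rw [Fintype.linearIndependent_iff]
  intro c hc
  -- A combination with zero horizontal part lies in `𝒢`, the span of the `G m u`, which meets the
  -- span of the `K m u` only in zero.
  have hY : ∑ m, c m • K m u ∈ vertKer L u := by
    refine ⟨(mem_vertical_iff p hs _).2 ?_, ?_⟩
    · refine (mvfderiv_baseFun (ContinuousLinearMap.id ℝ (Coord D)) hs _).symm.trans ?_
      rw [map_sum, ← hc]
      exact Finset.sum_congr rfl fun m _ => map_smul _ _ _
    · exact Submodule.sum_mem _ fun m _ => Submodule.smul_mem _ _ (h.mem_kerOmega hu m)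
  rw [← (h.basis_vert u hu).2] at hY
  have h0 := Submodule.disjoint_def.1 hd (∑ m, c m • K m u)
    (Submodule.sum_mem _ fun m _ => Submodule.smul_mem _ _ (Submodule.subset_span ⟨m, rfl⟩)) hY
  exact Fintype.linearIndependent_iff.1 hK c h0

theorem exists_dual_functionals {V : Type*} [NormedAddCommGroup V] [NormedSpace ℝ V]
    [FiniteDimensional ℝ V] {r : ℕ} {a : Fin r → V} (ha : LinearIndependent ℝ a) :
    ∃ φ : Fin r → V →L[ℝ] ℝ, ∀ m j, φ j (a m) = (1 : Matrix (Fin r) (Fin r) ℝ) m j := by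
  obtain ⟨g, hg⟩ := LinearMap.exists_leftInverse_of_injective
    (Fintype.linearCombination ℝ a) (LinearMap.ker_eq_bot.2
      ha.fintypeLinearCombination_injective)
  refine ⟨fun j => ((LinearMap.proj j).comp g).toContinuousLinearMap, fun m j => ?_⟩
  have h := congrArg (fun f => f (Pi.single m 1)) hg
  simp only [LinearMap.comp_apply, LinearMap.id_apply, Fintype.linearCombination_apply_single,
    one_smul] at h
  change g (a m) j = _
  rw [h, Matrix.one_apply, Pi.single_apply]
  simp only [eq_comm]

/-- The matrix of derivatives of the base functions `φ j` along the fields `K k`. -/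
def baseMatrix {r : ℕ} (p : Phase D Q) (φ : Fin r → Coord D →L[ℝ] ℝ) (K : Fin r → VField D Q)
    (u : Phase D Q) : Matrix (Fin r) (Fin r) ℝ :=
  Matrix.of fun k j => dirDeriv (K k) (baseFun p (φ j)) u

/-- Modulo vertical vectors, a vector of `ker Ω_L` is determined by its action on the base
functions. -/
theorem IsKerBasis.sub_mem_vertical {L : Phase D Q → ℝ} {U : Set (Phase D Q)} {r s : ℕ}
    {K : Fin r → VField D Q} {G : Fin s → VField D Q} (h : IsKerBasis L U K G) {p u : Phase D Q}
    (hu : u ∈ U) (hs : u ∈ (extChartAt (tModel D) p).source) {φ : Fin r → Coord D →L[ℝ] ℝ}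
    (hdet : (baseMatrix p φ K u).det ≠ 0) {Y : TPhase u} (hY : Y ∈ kerOmega L u) :
    Y - ∑ m, (∑ j, mvfderiv (tModel D) (baseFun p (φ j)) u Y * (baseMatrix p φ K u)⁻¹ j m) • K m u ∈
      vertical u := by
  rw [← (h.basis_ker u hu).2, Submodule.mem_span_range_iff_exists_fun] at hY
  obtain ⟨c, rfl⟩ := hY
  rw [Fintype.sum_sum_type]
  simp only [Sum.elim_inl, Sum.elim_inr]
  have hG : ∑ m, c (Sum.inr m) • G m u ∈ vertical u :=
    Submodule.sum_mem _ fun m _ => Submodule.smul_mem _ _ (h.mem_vertKer hu m).1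
  have hv : ∀ j, mvfderiv (tModel D) (baseFun p (φ j)) u
      (∑ m, c (Sum.inl m) • K m u + ∑ m, c (Sum.inr m) • G m u) =
      Matrix.vecMul (fun m => c (Sum.inl m)) (baseMatrix p φ K u) j := by
    intro j
    rw [map_add, mvfderiv_baseFun_of_vertical _ hs hG, add_zero, map_sum]
    exact Finset.sum_congr rfl fun m _ => map_smul _ _ _
  -- The derivatives of the base functions along the vector form the row `c A`; multiplying by `A⁻¹`
  -- recovers the `K`-coefficients `c`.
  have hc : ∀ m, ∑ j, mvfderiv (tModel D) (baseFun p (φ j)) u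
      (∑ m, c (Sum.inl m) • K m u + ∑ m, c (Sum.inr m) • G m u) * (baseMatrix p φ K u)⁻¹ j m =
      c (Sum.inl m) := by
    intro m
    simp only [hv]
    have h1 : Matrix.vecMul (Matrix.vecMul (fun m => c (Sum.inl m)) (baseMatrix p φ K u))
        (baseMatrix p φ K u)⁻¹ = fun m => c (Sum.inl m) := by
      rw [Matrix.vecMul_vecMul, Matrix.mul_nonsing_inv _ (isUnit_iff_ne_zero.2 hdet),
        Matrix.vecMul_one]
    exact congrFun h1 m
  simp only [hc, add_sub_cancel_left]
  exact hG

/-- A basis of `ker Ω_L` modulo `𝒢` on which base functions have constant derivatives is a basis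
of the reduced kernel. -/
theorem isCommonBasis_of_dual {L : Phase D Q → ℝ} (hL : ContMDiff (tModel D) 𝓘(ℝ, ℝ) ∞ L)
    {U : Set (Phase D Q)} (hU : IsOpen U) {r s : ℕ}
    {P : Fin r → VField D Q} {G : Fin s → VField D Q} (h : IsKerBasis L U P G) {p : Phase D Q}
    (hs : U ⊆ (extChartAt (tModel D) p).source) {φ : Fin r → Coord D →L[ℝ] ℝ}
    (hφ : ∀ u ∈ U, baseMatrix p φ P u = 1) : IsCommonBasis L U P G := by
  have hker : ∀ n, ∀ u ∈ U, P n u ∈ kerOmega L u := fun n u hu => h.mem_kerOmega hu n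
  have hP : ∀ n, P n ∈ kerBarFields L U := by
    refine fun n => ⟨h.smooth_K n, hker n, fun G' hG' u hu => ?_⟩
    have hb := bracket_mem_kerOmega hL hU hG'.1 (h.smooth_K n) (fun u hu => (hG'.2 u hu).2)
      (hker n) hu
    -- Both terms of the commutator differentiate constants: `P n` gives an entry of the identity
    -- matrix and the vertical `G'` gives zero.
    have hz : ∀ j, mvfderiv (tModel D) (baseFun p (φ j)) u (bracket G' (P n) u) = 0 := by
      intro j
      rw [dirDeriv_bracket hU hG'.1 (h.smooth_K n) ((contMDiffOn_baseFun p (φ j)).mono hs) hu,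
        dirDeriv_congr G' hU (f := dirDeriv (P n) (baseFun p (φ j)))
          (g := fun _ => (1 : Matrix (Fin r) (Fin r) ℝ) n j)
          (fun z hz => congrFun (congrFun (hφ z hz) n) j) hu, dirDeriv_const,
        dirDeriv_congr (P n) hU (f := dirDeriv G' (baseFun p (φ j))) (g := fun _ => 0)
          (fun z hz => mvfderiv_baseFun_of_vertical (φ j) (hs hz) (hG'.2 z hz).1) hu,
        dirDeriv_const, sub_zero]
    have h1 := h.sub_mem_vertical hu (hs hu) (φ := φ) (by rw [hφ u hu]; simp) hb
    simpa only [hz, zero_mul, Finset.sum_const_zero, zero_smul, sub_zero] using h1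
  have hG : ∀ m, G m ∈ kerBarFields L U := fun m =>
    ⟨h.smooth_G m, fun u hu => (h.mem_vertKer hu m).2, fun G' hG' u hu =>
      bracket_mem_vertical hU hG'.1 (h.smooth_G m) (fun u hu => (hG'.2 u hu).1)
        (fun u hu => (h.mem_vertKer hu m).1) hu⟩
  refine ⟨h, hP, hG, fun u hu => ⟨(h.basis_ker u hu).1, le_antisymm ?_ ?_⟩⟩
  · refine Submodule.span_le.2 ?_
    rintro _ ⟨n | m, rfl⟩
    · exact Submodule.subset_span ⟨U, hU, hu, P n, hP n, rfl⟩
    · exact Submodule.subset_span ⟨U, hU, hu, G m, hG m, rfl⟩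
  · rw [(h.basis_ker u hu).2]
    refine Submodule.span_le.2 ?_
    rintro _ ⟨V, -, huV, X, hX, rfl⟩
    exact hX.2.1 u huV

theorem baseMatrix_combination {r : ℕ} (p : Phase D Q) (φ : Fin r → Coord D →L[ℝ] ℝ)
    (K : Fin r → VField D Q) (om : Fin r → Fin r → Phase D Q → ℝ) (u : Phase D Q) :
    baseMatrix p φ (fun n u => ∑ m, om n m u • K m u) u =
      (Matrix.of fun n m => om n m u) * baseMatrix p φ K u := by
  ext n j
  rw [Matrix.mul_apply]
  change mvfderiv (tModel D) (baseFun p (φ j)) u (∑ m, om n m u • K m u) = _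
  rw [map_sum]
  exact Finset.sum_congr rfl fun m _ => map_smul _ _ _

/-- The witnesses are `om = A⁻¹` and `lam_l = (G_l A) A⁻¹` for the base matrix `A`; `om` normalizes
the base matrix of the new fields to the identity. -/
theorem exists_isCommonBasis_of_isKerBasis {L : Phase D Q → ℝ}
    (hL : ContMDiff (tModel D) 𝓘(ℝ, ℝ) ∞ L) {r s : ℕ}
    (hΩ : ∀ u, Module.finrank ℝ (kerOmega L u) = s + r) {W : Set (Phase D Q)} (hW : IsOpen W)
    {p : Phase D Q} (hp : p ∈ W) {K : Fin r → VField D Q} {G : Fin s → VField D Q}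
    (h : IsKerBasis L W K G) :
    ∃ U ⊆ W, IsOpen U ∧ p ∈ U ∧
      ∃ (lam : Fin s → Fin r → Fin r → Phase D Q → ℝ) (om : Fin r → Fin r → Phase D Q → ℝ),
        (∀ l k m, SmoothFunOn (lam l k m) U) ∧
        (∀ n m, SmoothFunOn (om n m) U) ∧
        (∀ u ∈ U, (Matrix.of fun n m => om n m u).det ≠ 0) ∧
        (∀ u ∈ U, ∀ l k,
          Ttau u (bracket (G l) (K k) u) = ∑ m, lam l k m u • Ttau u (K m u)) ∧
        (∀ u ∈ U, ∀ l n m, dirDeriv (G l) (om n m) u + ∑ k, om n k u * lam l k m u = 0) ∧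
        IsCommonBasis L U (fun n u => ∑ m, om n m u • K m u) G := by
  have hps := mem_extChartAt_source (I := tModel D) p
  obtain ⟨φ, hφ⟩ := exists_dual_functionals (h.linearIndependent_base hp hps)
  set A := baseMatrix p φ K with hA
  have hAp : A p = 1 := by
    ext m j
    rw [← hφ m j, mvfderiv_baseFun _ hps]
    exact mvfderiv_baseFun (φ j) hps _
  have hO : IsOpen (W ∩ (extChartAt (tModel D) p).source) :=
    hW.inter (isOpen_extChartAt_source p)
  have hAO : ∀ k j, SmoothFunOn (fun u => A u k j) (W ∩ (extChartAt (tModel D) p).source) :=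
    fun k j => smoothFunOn_dirDeriv hO ((h.smooth_K k).mono inter_subset_left)
      ((contMDiffOn_baseFun p (φ j)).mono inter_subset_right)
  let U := (W ∩ (extChartAt (tModel D) p).source) ∩ (fun u => (A u).det) ⁻¹' {0}ᶜ
  have hU : IsOpen U :=
    (SmoothFunOn.det hAO).continuousOn.isOpen_inter_preimage hO isOpen_compl_singleton
  have hUW : U ⊆ W := fun u hu => hu.1.1
  have hUs : U ⊆ (extChartAt (tModel D) p).source := fun u hu => hu.1.2
  have hdet : ∀ u ∈ U, (A u).det ≠ 0 := fun u hu => hu.2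
  have hAU : ∀ k j, SmoothFunOn (fun u => A u k j) U := fun k j => (hAO k j).mono inter_subset_left
  have hinv : ∀ i j, SmoothFunOn (fun u => (A u)⁻¹ i j) U := SmoothFunOn.matrix_inv hAU hdet
  have hKU := h.mono hUW
  have hmulA : ∀ u ∈ U, (A u)⁻¹ * A u = 1 := fun u hu =>
    Matrix.nonsing_inv_mul _ (isUnit_iff_ne_zero.2 (hdet u hu))
  have hAmul : ∀ u ∈ U, A u * (A u)⁻¹ = 1 := fun u hu =>
    Matrix.mul_nonsing_inv _ (isUnit_iff_ne_zero.2 (hdet u hu))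
  -- The other term of the commutator vanishes, because `G l` is vertical and annihilates base
  -- functions.
  have hbr : ∀ u ∈ U, ∀ l k j, mvfderiv (tModel D) (baseFun p (φ j)) u (bracket (G l) (K k) u) =
      dirDeriv (G l) (fun z => A z k j) u := by
    intro u hu l k j
    rw [dirDeriv_bracket hU (hKU.smooth_G l) (hKU.smooth_K k)
      ((contMDiffOn_baseFun p (φ j)).mono hUs) hu,
      dirDeriv_congr (K k) hU (f := dirDeriv (G l) (baseFun p (φ j))) (g := fun _ => 0)
        (fun z hz => mvfderiv_baseFun_of_vertical (φ j) (hUs hz) (hKU.mem_vertKer hz l).1) hu,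
      dirDeriv_const, sub_zero]
    rfl
  have hP : IsKerBasis L U (fun n u => ∑ m, (A u)⁻¹ n m • K m u) G := by
    refine ⟨fun n => ?_, hKU.smooth_G, hKU.basis_vert, fun u hu => ?_⟩
    · exact ContMDiffOn.sum_section fun m _ => (hinv n m).smul_section (hKU.smooth_K m)
    · refine isBasisOf_of_card ?_ ?_ (by
        rw [hΩ, Fintype.card_sum, Fintype.card_fin, Fintype.card_fin, add_comm])
      · rw [Fintype.linearIndependent_iff]
        intro c hc
        rw [Fintype.sum_sum_type] at hc
        simp only [Sum.elim_inl, Sum.elim_inr] at hc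
        -- Differentiating the base function `φ j` along the relation kills the `G` part and
        -- isolates one coefficient, since `A⁻¹ A = 1`.
        have hl : ∀ j, c (Sum.inl j) = 0 := by
          intro j
          have h1 := congrArg (mvfderiv (tModel D) (baseFun p (φ j)) u) hc
          rw [map_add, mvfderiv_baseFun_of_vertical _ (hUs hu) (Submodule.sum_mem _ fun m _ =>
            Submodule.smul_mem _ _ (hKU.mem_vertKer hu m).1), add_zero, map_zero, map_sum] at h1
          have h2 : ∑ n, c (Sum.inl n) *
              baseMatrix p φ (fun n u => ∑ m, (A u)⁻¹ n m • K m u) u n j = 0 :=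
            (Finset.sum_congr rfl fun n _ => (map_smul _ _ _).symm).trans h1
          rw [baseMatrix_combination] at h2
          change ∑ n, c (Sum.inl n) * ((A u)⁻¹ * A u) n j = 0 at h2
          simpa [hmulA u hu, Matrix.one_apply] using h2
        simp only [hl, zero_smul, Finset.sum_const_zero, zero_add] at hc
        have hr := Fintype.linearIndependent_iff.1 (hKU.basis_vert u hu).1 _ hc
        rintro (n | m)
        · exact hl n
        · exact hr m
      · rintro (n | m)
        · exact Submodule.sum_mem _ fun m _ =>
            Submodule.smul_mem _ _ (hKU.mem_kerOmega hu m)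
        · exact (hKU.mem_vertKer hu m).2
  refine ⟨U, hUW, hU, ⟨⟨hp, hps⟩, by simp [hAp]⟩,
    fun l k m u => ∑ j, dirDeriv (G l) (fun z => A z k j) u * (A u)⁻¹ j m,
    fun n m u => (A u)⁻¹ n m, ?_, hinv, ?_, ?_, ?_, ?_⟩
  · exact fun l k m => contMDiffOn_finsetSum fun j _ =>
      (smoothFunOn_dirDeriv hU (hKU.smooth_G l) (hAU k j)).mul (hinv j m)
  · intro u hu
    change ((A u)⁻¹).det ≠ 0
    exact (Matrix.isUnit_nonsing_inv_det _ (isUnit_iff_ne_zero.2 (hdet u hu))).ne_zero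
  · intro u hu l k
    have hb := bracket_mem_kerOmega hL hU (hKU.smooth_G l) (hKU.smooth_K k)
      (fun u hu => (hKU.mem_vertKer hu l).2) (fun u hu => hKU.mem_kerOmega hu k) hu
    have h1 := hKU.sub_mem_vertical hu (hUs hu) (hdet u hu) hb
    simp only [hbr u hu l k] at h1
    have h2 : Ttau u _ = 0 := h1
    rw [map_sub, sub_eq_zero, map_sum] at h2
    simpa only [map_smul] using h2
  · intro u hu l n m
    -- The Leibniz rule applied to `A⁻¹ A = 1` along `G l`; multiplying on the right by `A⁻¹` then
    -- gives the equation for `om`.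
    have h1 : ∀ j, ∑ i, (dirDeriv (G l) (fun z => (A z)⁻¹ n i) u * A u i j +
        (A u)⁻¹ n i * dirDeriv (G l) (fun z => A z i j) u) = 0 := by
      intro j
      rw [← dirDeriv_sum_mul (G l) hU (fun i => hinv n i) (fun i => hAU i j) hu,
        dirDeriv_congr (G l) hU (g := fun _ => (1 : Matrix (Fin r) (Fin r) ℝ) n j)
          (fun z hz => ?_) hu, dirDeriv_const]
      rw [← hmulA z hz, Matrix.mul_apply]
    let B : Matrix (Fin r) (Fin r) ℝ :=
      Matrix.of fun i j => dirDeriv (G l) (fun z => A z i j) u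
    let C : Matrix (Fin r) (Fin r) ℝ :=
      Matrix.of fun i j => dirDeriv (G l) (fun z => (A z)⁻¹ i j) u
    have h2 : ∀ j, (C * A u + (A u)⁻¹ * B) n j = 0 := by
      intro j
      rw [Matrix.add_apply, Matrix.mul_apply, Matrix.mul_apply, ← Finset.sum_add_distrib]
      exact h1 j
    have h3 : (C + (A u)⁻¹ * (B * (A u)⁻¹)) n m = 0 := by
      have e : C + (A u)⁻¹ * (B * (A u)⁻¹) = (C * A u + (A u)⁻¹ * B) * (A u)⁻¹ := by
        rw [add_mul, mul_assoc, hAmul u hu, mul_one, mul_assoc]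
      rw [e, Matrix.mul_apply]
      exact Finset.sum_eq_zero fun j _ => by rw [h2 j, zero_mul]
    rw [Matrix.add_apply, Matrix.mul_apply] at h3
    exact h3
  · refine isCommonBasis_of_dual hL hU hP hUs (φ := φ) fun u hu => ?_
    rw [baseMatrix_combination]
    exact hmulA u hu

end CommonBasis

end LagrangianPhaseSpace

end

theorem mainTheorem7 {D : ℕ} {Q : Type*} [TopologicalSpace Q]
    [ChartedSpace (EuclideanSpace ℝ (Fin D)) Q] [IsManifold (𝓡 D) ∞ Q]
    (L : TangentBundle (𝓡 D) Q → ℝ)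
    (hL : ContMDiff (𝓡 D).tangent 𝓘(ℝ, ℝ) ∞ L) (N₀ Dbar : ℕ)
    (hM : ∀ u, Module.finrank ℝ
      (LinearMap.ker (hessian L u).toLinearMap) = N₀)
    (hΩ : ∀ u, Module.finrank ℝ (kerOmega L u) = N₀ + Dbar)
    (u₀ : TangentBundle (𝓡 D) Q) :
    (∃ U : Set (TangentBundle (𝓡 D) Q), IsOpen U ∧ u₀ ∈ U ∧
      ∃ (P : Fin Dbar → VField D Q)
        (G : Fin N₀ → VField D Q),
        IsCommonBasis L U P G) ∧
    (∀ (W : Set (TangentBundle (𝓡 D) Q)) (K : Fin Dbar → VField D Q)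
      (G : Fin N₀ → VField D Q),
      IsOpen W → u₀ ∈ W → IsKerBasis L W K G →
      ∃ U ⊆ W, IsOpen U ∧ u₀ ∈ U ∧
        ∃ (lam : Fin N₀ → Fin Dbar → Fin Dbar → TangentBundle (𝓡 D) Q → ℝ)
          (om : Fin Dbar → Fin Dbar → TangentBundle (𝓡 D) Q → ℝ),
          (∀ l k m, SmoothFunOn (lam l k m) U) ∧
          (∀ n m, SmoothFunOn (om n m) U) ∧
          (∀ u ∈ U, (Matrix.of fun n m => om n m u).det ≠ 0) ∧
          (∀ u ∈ U, ∀ l k,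
            Ttau u (bracket (G l) (K k) u) =
              ∑ m, lam l k m u • Ttau u (K m u)) ∧
          (∀ u ∈ U, ∀ l n m,
            dirDeriv (G l) (om n m) u + ∑ k, om n k u * lam l k m u = 0) ∧
          IsCommonBasis L U (fun n u => ∑ m, om n m u • K m u) G) := by
  have hV := fun u => (finrank_vertKer hL u).trans (hM u)
  have key := fun (W : Set (TangentBundle (𝓡 D) Q)) (K : Fin Dbar → VField D Q)
    (G : Fin N₀ → VField D Q) (hW : IsOpen W) (hp : u₀ ∈ W) (h : IsKerBasis L W K G) =>
      exists_isCommonBasis_of_isKerBasis hL hΩ hW hp h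
  refine ⟨?_, key⟩
  obtain ⟨W, hW, hp, K, G, h⟩ := exists_isKerBasis hL hV hΩ u₀
  obtain ⟨U, -, hU, hpU, -, om, -, -, -, -, -, hC⟩ := key W K G hW hp h
  exact ⟨U, hU, hpU, _, G, hC⟩
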